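/- Let $n,N\ge 1$, let $\Omega\subset\mathbb R^n$ be bounded and open, let $\Gamma\subset\mathbb R^n$ be bounded and measurable, and put $S:=\Omega\cup\Gamma$. Suppose that there is $\delta>0$ with $\bigcup_{x\in\Omega}B_\delta(x)\subseteq\Omega\cup\Gamma$. For $\psi:S\to\mathbb R^N$ write $\widehat\psi(x,y)=\psi(y)-\psi(x)$, and let $\widehat S=\{y-x:x,y\in S\}$. For $p\in[1,\infty)$ and a measurable weight $\beta:S\times\widehat S\to\mathbb R$ let $$W^p_\beta(S)=\Big\{u\in L^p(S;\mathbb R^N):\int_{S^2}|\beta(x,y-x)|\,|\widehat u(x,y)|^p\,dx\,dy<\infty\Big\},$$ $$W^p_{\beta,0}(S)=\{u\in W^p_\beta(S): u=0\text{ a.e. on }\Gamma\}.$$ Let $1\le q<p<\infty$ and let $f:S\times\widehat S\times\mathbb R^N\times\mathbb R^N\to\mathbb R$, $(x,z,u,\xi)\mapsto f(x,z,u,\xi)$, be such that * for all $u,\xi\in\mathbb R^N$ the function $(x,y)\mapsto f(x,y-x,u,\xi)$ is measurable on $S^2$; * for a.e. $(x,y)\in S^2$ the function $(u,\xi)\mapsto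 f(x,y-x,u,\xi)$ is continuous and (jointly) convex; * for a.e. $(x,y)\in S^2$ and all $u,\xi\in\mathbb R^N$, $$f(x,y-x,u,\xi)\ \ge\ \alpha_1(x,y-x)|\xi|^p+\alpha_2(x,y-x)|u|^q+\alpha_3(x,y-x).$$ Here $\alpha_1,\alpha_2,\alpha_3:S\times\widehat S\to\mathbb R$, the function $(x,y)\mapsto\alpha_1(x,y-x)$ is measurable and a.e. nonnegative on $S^2$, there is a constant $C_0>0$ with $\alpha_1(x,y-x)\ge C_0\chi_{B_\delta(x)}(y)$ for a.e. $(x,y)\in\Omega\times S$, the function $(x,y)\mapsto\alpha_2(x,y-x)$ belongs to $L^{p/(p-q)}(S^2)$, and $(x,y)\mapsto\alpha_3(x,y-x)$ belongs to $L^1(S^2)$. No upper growth condition is imposed on $f$. Let $$\mathcal F(u)=\int_S\int_S f\big(x,y-x,u(x),u(y)-u(x)\big)\,dy\,dx,$$ let $u_0\in W^p_{\alpha_1}(S)$ satisfy $\mathcal F(u_0)<\infty$, and set $$\mathcal A=\{v\in W^p_{\alpha_1}(S): v-u_0\in W^p_{\alpha_1,0}(S)\}.$$ Then for every $v\in\mathcal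 A$ the negative part of the integrand of $\mathcal F(v)$ is integrable on $S^2$, so that $\mathcal F(v)\in(-\infty,\infty]$ is well defined, and there is $u\in\mathcal A$ with $$\mathcal F(u)=\inf\{\mathcal F(v):v\in\mathcal A\}.$$ -/

import Mathlib

open MeasureTheory Set

noncomputable section

/-- The nonlocal difference `ψ̂(x, y) = ψ(y) - ψ(x)`, as a function of the pair `(x, y)`. -/
def hatDiff {n N : ℕ} (ψ : EuclideanSpace ℝ (Fin n) → EuclideanSpace ℝ (Fin N))
    (w : EuclideanSpace ℝ (Fin n) × EuclideanSpace ℝ (Fin n)) : EuclideanSpace ℝ (Fin N) :=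
  ψ w.2 - ψ w.1

/-- A kernel `g(x, z)`, evaluated at `z = y - x`, as a function of the pair `(x, y)`. -/
def pairKernel {n : ℕ} (g : EuclideanSpace ℝ (Fin n) → EuclideanSpace ℝ (Fin n) → ℝ)
    (w : EuclideanSpace ℝ (Fin n) × EuclideanSpace ℝ (Fin n)) : ℝ :=
  g w.1 (w.2 - w.1)

/-- `L^p_β(S²; ℝᴺ)`: measurable `h` on `S²` with `∫_{S²} |β(x, y - x)| |h(x, y)|^p dx dy < ∞`
(functions are not identified when they agree a.e.). -/
def weightedLp {n : ℕ} (N : ℕ) (S : Set (EuclideanSpace ℝ (Fin n))) (p : ℝ)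
    (β : EuclideanSpace ℝ (Fin n) → EuclideanSpace ℝ (Fin n) → ℝ) :
    Set (EuclideanSpace ℝ (Fin n) × EuclideanSpace ℝ (Fin n) → EuclideanSpace ℝ (Fin N)) :=
  {h | AEStronglyMeasurable h (volume.restrict (S ×ˢ S)) ∧
    ∫⁻ w in S ×ˢ S, ENNReal.ofReal (|pairKernel β w| * ‖h w‖ ^ p) < ⊤}

/-- `W^p_β(S; ℝᴺ)`: functions in `L^p(S; ℝᴺ)` whose nonlocal difference lies in `L^p_β(S²; ℝᴺ)`. -/
def nonlocalW {n : ℕ} (N : ℕ) (S : Set (EuclideanSpace ℝ (Fin n))) (p : ℝ)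
    (β : EuclideanSpace ℝ (Fin n) → EuclideanSpace ℝ (Fin n) → ℝ) :
    Set (EuclideanSpace ℝ (Fin n) → EuclideanSpace ℝ (Fin N)) :=
  {u | MemLp u (ENNReal.ofReal p) (volume.restrict S) ∧ hatDiff u ∈ weightedLp N S p β}

/-- `W^p_{β,0}(Ω ∪ Γ; ℝᴺ)`: members of `W^p_β(Ω ∪ Γ; ℝᴺ)` that vanish a.e. on `Γ`. -/
def nonlocalWZero {n : ℕ} (N : ℕ) (Ω Γ : Set (EuclideanSpace ℝ (Fin n))) (p : ℝ)
    (β : EuclideanSpace ℝ (Fin n) → EuclideanSpace ℝ (Fin n) → ℝ) :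
    Set (EuclideanSpace ℝ (Fin n) → EuclideanSpace ℝ (Fin N)) :=
  {u | u ∈ nonlocalW N (Ω ∪ Γ) p β ∧ ∀ᵐ x ∂(volume.restrict Γ), u x = 0}

/-- The admissible class `{v ∈ W^p_β(Ω ∪ Γ; ℝᴺ) : v - u₀ ∈ W^p_{β,0}(Ω ∪ Γ; ℝᴺ)}`. -/
def admissibleClass {n N : ℕ} (Ω Γ : Set (EuclideanSpace ℝ (Fin n))) (p : ℝ)
    (β : EuclideanSpace ℝ (Fin n) → EuclideanSpace ℝ (Fin n) → ℝ)
    (u₀ : EuclideanSpace ℝ (Fin n) → EuclideanSpace ℝ (Fin N)) :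
    Set (EuclideanSpace ℝ (Fin n) → EuclideanSpace ℝ (Fin N)) :=
  {v | v ∈ nonlocalW N (Ω ∪ Γ) p β ∧ v - u₀ ∈ nonlocalWZero N Ω Γ p β}

/-- The integrand `(x, y) ↦ f(x, y - x, u(x), u(y) - u(x))`. -/
def energyDensity {n N : ℕ}
    (f : EuclideanSpace ℝ (Fin n) → EuclideanSpace ℝ (Fin n) →
      EuclideanSpace ℝ (Fin N) → EuclideanSpace ℝ (Fin N) → ℝ)
    (u : EuclideanSpace ℝ (Fin n) → EuclideanSpace ℝ (Fin N))
    (w : EuclideanSpace ℝ (Fin n) × EuclideanSpace ℝ (Fin n)) : ℝ :=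
  f w.1 (w.2 - w.1) (u w.1) (hatDiff u w)

/-- `∫_{S²}` of the positive part of the integrand. -/
def energyPos {n N : ℕ} (S : Set (EuclideanSpace ℝ (Fin n)))
    (f : EuclideanSpace ℝ (Fin n) → EuclideanSpace ℝ (Fin n) →
      EuclideanSpace ℝ (Fin N) → EuclideanSpace ℝ (Fin N) → ℝ)
    (u : EuclideanSpace ℝ (Fin n) → EuclideanSpace ℝ (Fin N)) : ENNReal :=
  ∫⁻ w in S ×ˢ S, ENNReal.ofReal (energyDensity f u w)

/-- `∫_{S²}` of the negative part of the integrand. -/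
def energyNeg {n N : ℕ} (S : Set (EuclideanSpace ℝ (Fin n)))
    (f : EuclideanSpace ℝ (Fin n) → EuclideanSpace ℝ (Fin n) →
      EuclideanSpace ℝ (Fin N) → EuclideanSpace ℝ (Fin N) → ℝ)
    (u : EuclideanSpace ℝ (Fin n) → EuclideanSpace ℝ (Fin N)) : ENNReal :=
  ∫⁻ w in S ×ˢ S, ENNReal.ofReal (-energyDensity f u w)

/-- The functional `F[u] = ∫_S ∫_S f(x, y - x, u(x), u(y) - u(x)) dy dx`, with extended real
values: the integral of the positive part minus that of the negative part. It is meaningful when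
`energyNeg S f u < ⊤`, and then takes values in `(-∞, ∞]`. -/
def energy {n N : ℕ} (S : Set (EuclideanSpace ℝ (Fin n)))
    (f : EuclideanSpace ℝ (Fin n) → EuclideanSpace ℝ (Fin n) →
      EuclideanSpace ℝ (Fin N) → EuclideanSpace ℝ (Fin N) → ℝ)
    (u : EuclideanSpace ℝ (Fin n) → EuclideanSpace ℝ (Fin N)) : EReal :=
  (energyPos S f u : EReal) - (energyNeg S f u : EReal)

end

/-! This is the direct method, with weak compactness replaced by an almost everywhere selection. The
coercivity bound, with its `|u|^q` term absorbed by Young's inequality, together with a Poincaré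
inequality for functions vanishing on `Γ`, bounds the weighted seminorm and the `L^p` norm on
sublevel sets of the energy. These sets are midpoint convex because `f` is jointly convex, they
decrease as the level tends to the infimum, and they are bounded in `L¹(S)`.

`exists_mem_ae_tendsto_of_antitone` picks near-minimisers of the strictly convex functional `∫ √(1 +
|v|²)` in these sets. A midpoint of two members stays in the set and so cannot do much better than
they do; quantitative strict convexity then forces consecutive members to be close. The result is an
energy-minimising sequence converging a.e. to some `u`. Continuity of `f` and Fatou's lemma give
that the energy of `u` is at most the infimum. Fatou needs only a lower bound on the integrand,
hence no upper growth condition.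

The Poincaré inequality (`exists_nonlocal_poincare`) rests on shifts `z` with `δ/2 < |z| < δ`:
boundedly many steps of length `|z|` leave the bounded set `Ω`, so telescoping controls `w` by `w(x
+ z) - w(x)`, and integrating over `z` produces the double integral. -/

open Filter Topology

/-! ### Fatou's lemma, superposition, extended-valued integrals, Young's inequality. -/

section Generic

variable {α : Type*} [MeasurableSpace α] {μ : Measure α}

/-- Fatou's lemma for nonnegative integrable functions with bounded integrals. -/
lemma integrable_and_integral_le_of_tendsto_ae {g : ℕ → α → ℝ} {g' : α → ℝ} {c : ℝ}
    (hg : ∀ k, Integrable (g k) μ) (hpos : ∀ k, 0 ≤ᵐ[μ] g k)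
    (hlim : ∀ᵐ w ∂μ, Tendsto (fun k => g k w) atTop (𝓝 (g' w)))
    (hc : ∀ k, ∫ w, g k w ∂μ ≤ c) :
    Integrable g' μ ∧ 0 ≤ᵐ[μ] g' ∧ ∫ w, g' w ∂μ ≤ c := by
  have hpos' : 0 ≤ᵐ[μ] g' := by
    filter_upwards [hlim, ae_all_iff.2 hpos] with w hw h
    exact ge_of_tendsto' hw h
  have hmeas : AEStronglyMeasurable g' μ :=
    aestronglyMeasurable_of_tendsto_ae atTop (fun k => (hg k).1) hlim
  have hc0 : 0 ≤ c := (integral_nonneg_of_ae (hpos 0)).trans (hc 0)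
  have key : ∫⁻ w, ENNReal.ofReal (g' w) ∂μ ≤ ENNReal.ofReal c := by
    calc ∫⁻ w, ENNReal.ofReal (g' w) ∂μ
        = ∫⁻ w, liminf (fun k => ENNReal.ofReal (g k w)) atTop ∂μ := by
          refine lintegral_congr_ae ?_
          filter_upwards [hlim] with w hw
          exact ((ENNReal.continuous_ofReal.tendsto _).comp hw).liminf_eq.symm
      _ ≤ liminf (fun k => ∫⁻ w, ENNReal.ofReal (g k w) ∂μ) atTop :=
          lintegral_liminf_le' fun k => (hg k).1.aemeasurable.ennreal_ofReal
      _ ≤ ENNReal.ofReal c := by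
          refine liminf_le_of_le (by isBoundedDefault) fun b hb => ?_
          obtain ⟨k, hk⟩ := hb.exists
          refine hk.trans ?_
          rw [← ofReal_integral_eq_lintegral_ofReal (hg k) (hpos k)]
          exact ENNReal.ofReal_le_ofReal (hc k)
  have hint : Integrable g' μ :=
    ⟨hmeas, (hasFiniteIntegral_iff_ofReal hpos').2 (key.trans_lt ENNReal.ofReal_lt_top)⟩
  refine ⟨hint, hpos', ?_⟩
  rw [← ofReal_integral_eq_lintegral_ofReal hint hpos'] at key
  exact (ENNReal.ofReal_le_ofReal_iff hc0).1 key

/-- Superposition with a Carathéodory function preserves measurability. -/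
lemma aemeasurable_caratheodory {A : Type*} [TopologicalSpace A]
    [TopologicalSpace.PseudoMetrizableSpace A] [SecondCountableTopology A] [MeasurableSpace A]
    [BorelSpace A] {F : α → A → ℝ} (hF : ∀ a, AEMeasurable (fun w => F w a) μ)
    (hc : ∀ᵐ w ∂μ, Continuous (F w)) {g : α → A} (hg : AEStronglyMeasurable g μ) :
    AEMeasurable (fun w => F w (g w)) μ := by
  classical
  obtain ⟨g', hg', hgg'⟩ := hg
  -- On a simple function the superposition is a finite sum of the `F · a` cut off to fibres;
  -- continuity in `a` then passes to the limit along simple approximations.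
  have hs : ∀ s : SimpleFunc α A, AEMeasurable (fun w => F w (s w)) μ := by
    intro s
    have : (fun w => F w (s w)) =
        fun w => ∑ a ∈ s.range, (s ⁻¹' {a}).indicator (fun w => F w a) w := by
      funext w
      rw [Finset.sum_eq_single (s w)]
      · simp
      · intro b _ hb
        simp [indicator, hb.symm]
      · intro h
        exact absurd (s.mem_range_self w) h
    rw [this]
    exact Finset.aemeasurable_fun_sum _ fun a _ => (hF a).indicator (s.measurableSet_fiber a)
  refine aemeasurable_of_tendsto_metrizable_ae atTop (fun k => hs (hg'.approx k)) ?_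
  filter_upwards [hc, hgg'] with w hw hgw
  rw [hgw]
  exact (hw.tendsto _).comp (hg'.tendsto_approx w)

/-- If the negative part is integrable and the difference of the integrals is not `⊤`, then the
function is integrable. -/
lemma integrable_of_lintegral_sub_lt_top {e : α → ℝ} (he : AEMeasurable e μ)
    (hneg : ∫⁻ w, ENNReal.ofReal (-e w) ∂μ < ⊤)
    (h : ((∫⁻ w, ENNReal.ofReal (e w) ∂μ : ENNReal) : EReal)
      - ((∫⁻ w, ENNReal.ofReal (-e w) ∂μ : ENNReal) : EReal) < ⊤) : Integrable e μ := by
  refine ⟨he.aestronglyMeasurable, ?_⟩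
  have hpos : ∫⁻ w, ENNReal.ofReal (e w) ∂μ < ⊤ := by
    by_contra hcon
    rw [not_lt, top_le_iff] at hcon
    rw [hcon] at h
    lift (∫⁻ w, ENNReal.ofReal (-e w) ∂μ) to NNReal using hneg.ne with r
    exact absurd h (by simp)
  rw [HasFiniteIntegral]
  calc ∫⁻ w, ‖e w‖ₑ ∂μ
      ≤ ∫⁻ w, (ENNReal.ofReal (e w) + ENNReal.ofReal (-e w)) ∂μ := by
        refine lintegral_mono fun w => ?_
        rw [Real.enorm_eq_ofReal_abs]
        rcases abs_cases (e w) with h | h <;> rw [h.1] <;> simp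
    _ = _ := lintegral_add_left' he.ennreal_ofReal _
    _ < ⊤ := ENNReal.add_lt_top.2 ⟨hpos, hneg⟩

lemma lintegral_sub_eq_integral {e : α → ℝ} (he : Integrable e μ) :
    ((∫⁻ w, ENNReal.ofReal (e w) ∂μ : ENNReal) : EReal)
      - ((∫⁻ w, ENNReal.ofReal (-e w) ∂μ : ENNReal) : EReal) = ((∫ w, e w ∂μ : ℝ) : EReal) := by
  have h1 : ∫⁻ w, ENNReal.ofReal (e w) ∂μ ≠ ⊤ :=
    ((lintegral_mono fun w => ENNReal.ofReal_le_ofReal (le_abs_self _)).trans_lt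
      ((hasFiniteIntegral_iff_norm e).1 he.2)).ne
  have h2 : ∫⁻ w, ENNReal.ofReal (-e w) ∂μ ≠ ⊤ :=
    ((lintegral_mono fun w => ENNReal.ofReal_le_ofReal (neg_le_abs _)).trans_lt
      ((hasFiniteIntegral_iff_norm e).1 he.2)).ne
  rw [integral_eq_lintegral_pos_part_sub_lintegral_neg_part he, EReal.coe_sub,
    EReal.coe_ennreal_toReal h1, EReal.coe_ennreal_toReal h2]

/-- Young's inequality with a small constant. -/
lemma exists_young {p q ε : ℝ} (hq : 1 ≤ q) (hqp : q < p) (hε : 0 < ε) :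
    ∃ C : ℝ, 0 ≤ C ∧ ∀ a b : ℝ, 0 ≤ a → 0 ≤ b →
      a * b ^ q ≤ ε * b ^ p + C * a ^ (p / (p - q)) := by
  have hq0 : 0 < q := by linarith
  have hp0 : 0 < p := by linarith
  have hpq : 0 < p - q := by linarith
  have hconj : (p / q).HolderConjugate (p / (p - q)) := by
    rw [Real.holderConjugate_iff]
    refine ⟨(one_lt_div hq0).2 hqp, ?_⟩
    field_simp
    ring
  -- Chosen so that `(l * b ^ q) ^ (p / q) = ε * b ^ p`; Young is applied to `l * b ^ q` and `l⁻¹ *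
  -- a`, and its denominators are dropped.
  set l : ℝ := ε ^ (q / p) with hl
  have hl0 : 0 < l := Real.rpow_pos_of_pos hε _
  refine ⟨(l⁻¹) ^ (p / (p - q)), by positivity, fun a b ha hb => ?_⟩
  have h := Real.young_inequality_of_nonneg (a := l * b ^ q) (b := l⁻¹ * a)
    (by positivity) (by positivity) hconj
  have e1 : (l * b ^ q) ^ (p / q) = ε * b ^ p := by
    rw [Real.mul_rpow hl0.le (by positivity), hl, ← Real.rpow_mul hε.le, ← Real.rpow_mul hb]
    congr 2
    · rw [show q / p * (p / q) = 1 by field_simp, Real.rpow_one]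
    · field_simp
  have e2 : (l⁻¹ * a) ^ (p / (p - q)) = (l⁻¹) ^ (p / (p - q)) * a ^ (p / (p - q)) :=
    Real.mul_rpow (by positivity) ha
  calc a * b ^ q = (l * b ^ q) * (l⁻¹ * a) := by field_simp
    _ ≤ _ := h
    _ ≤ (l * b ^ q) ^ (p / q) + (l⁻¹ * a) ^ (p / (p - q)) :=
        add_le_add (div_le_self (by positivity) hconj.lt.le)
          (div_le_self (by positivity) hconj.symm.lt.le)
    _ = _ := by rw [e1, e2]

end Generic

/-! ### Almost everywhere convergent selections from decreasing midpoint-convex sets. -/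

section Selection

variable {H : Type*} [NormedAddCommGroup H]

/-- The regularised norm `√(1 + |a|²)`. -/
noncomputable def regNorm (a : H) : ℝ := √(1 + ‖a‖ ^ 2)

lemma regNorm_sq (a : H) : regNorm a ^ 2 = 1 + ‖a‖ ^ 2 := Real.sq_sqrt (by positivity)

lemma one_le_regNorm (a : H) : 1 ≤ regNorm a :=
  Real.one_le_sqrt.2 (by nlinarith [norm_nonneg a])

lemma regNorm_le (a : H) : regNorm a ≤ 1 + ‖a‖ :=
  Real.sqrt_le_iff.2 ⟨by positivity, by nlinarith [norm_nonneg a]⟩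

lemma continuous_regNorm : Continuous (regNorm : H → ℝ) := by
  unfold regNorm; fun_prop

variable {α : Type*} [MeasurableSpace α] {μ : Measure α}

/-- Summing under the integral makes `∑ √‖v k - v (k + 1)‖` finite a.e. Its terms are eventually at
most `1`, where `t ≤ √t`, so the increments themselves are summable. -/
lemma ae_exists_tendsto_of_summable_integral_sqrt [CompleteSpace H] {v : ℕ → α → H}
    {b : ℕ → ℝ} (hb : Summable b)
    (hi : ∀ k, Integrable (fun w => √‖v k w - v (k + 1) w‖) μ)
    (h : ∀ k, ∫ w, √‖v k w - v (k + 1) w‖ ∂μ ≤ b k) :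
    ∀ᵐ w ∂μ, ∃ a, Tendsto (fun k => v k w) atTop (𝓝 a) := by
  have hfin : ∫⁻ w, ∑' k, ENNReal.ofReal √‖v k w - v (k + 1) w‖ ∂μ ≠ ⊤ := by
    rw [lintegral_tsum fun k => (hi k).1.aemeasurable.ennreal_ofReal]
    refine ne_top_of_le_ne_top hb.tsum_ofReal_ne_top (ENNReal.tsum_le_tsum fun k => ?_)
    rw [← ofReal_integral_eq_lintegral_ofReal (hi k)
      (Eventually.of_forall fun w => Real.sqrt_nonneg _)]
    exact ENNReal.ofReal_le_ofReal (h k)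
  have hm : AEMeasurable (fun w => ∑' k, ENNReal.ofReal √‖v k w - v (k + 1) w‖) μ :=
    AEMeasurable.tsum fun k => (hi k).1.aemeasurable.ennreal_ofReal
  filter_upwards [ae_lt_top' hm hfin] with w hw
  have hsum : Summable fun k => √‖v k w - v (k + 1) w‖ := by
    have := ENNReal.summable_toReal hw.ne
    simpa [ENNReal.toReal_ofReal (Real.sqrt_nonneg _)] using this
  have hsum' : Summable fun k => dist (v k w) (v (k + 1) w) := by
    refine hsum.of_norm_bounded_eventually_nat ?_
    filter_upwards [hsum.tendsto_atTop_zero.eventually_le_const one_pos] with k hk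
    rw [Real.norm_of_nonneg dist_nonneg, dist_eq_norm]
    nlinarith [Real.sq_sqrt (norm_nonneg (v k w - v (k + 1) w)),
      Real.sqrt_nonneg ‖v k w - v (k + 1) w‖]
  exact cauchySeq_tendsto_of_complete (cauchySeq_of_summable_dist hsum')

variable [InnerProductSpace ℝ H]

/-- Quantitative strict convexity of `regNorm`. -/
lemma norm_sub_sq_le_regNorm_gap (a b : H) :
    0 ≤ (regNorm a + regNorm b) / 2 - regNorm ((1 / 2 : ℝ) • (a + b)) ∧
    ‖a - b‖ ^ 2 ≤ ((regNorm a + regNorm b) / 2 - regNorm ((1 / 2 : ℝ) • (a + b)))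
      * (regNorm a + regNorm b) ^ 3 := by
  have hA := regNorm_sq a
  have hB := regNorm_sq b
  have hM := regNorm_sq ((1 / 2 : ℝ) • (a + b))
  have hA1 := one_le_regNorm a
  have hB1 := one_le_regNorm b
  have hM1 := one_le_regNorm ((1 / 2 : ℝ) • (a + b))
  have hpar := parallelogram_law_with_norm ℝ a b
  have hn : ‖(1 / 2 : ℝ) • (a + b)‖ = ‖a + b‖ / 2 := by
    rw [norm_smul]; norm_num; ring
  rw [hn] at hM
  have hab : |‖a‖ - ‖b‖| ≤ ‖a - b‖ := abs_norm_sub_norm_le a b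
  have hab2 : (‖a‖ - ‖b‖) ^ 2 ≤ ‖a - b‖ ^ 2 := by
    rw [← sq_abs]; gcongr
  set A := regNorm a
  set B := regNorm b
  set M := regNorm ((1 / 2 : ℝ) • (a + b))
  set d := ‖a - b‖
  have ha := norm_nonneg a
  have hb := norm_nonneg b
  set x := ‖a‖
  set y := ‖b‖
  have h4M : 4 * M ^ 2 = 2 * A ^ 2 + 2 * B ^ 2 - d ^ 2 := by nlinarith
  -- Cauchy–Schwarz for the vectors `(1, x)` and `(1, y)`.
  have hAB : 1 + x * y ≤ A * B := by
    refine abs_le_of_sq_le_sq' ?_ (by positivity) |>.2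
    rw [mul_pow, hA, hB]
    nlinarith [sq_nonneg (x - y)]
  have hxy : (x + y) ^ 2 ≤ (A + B) ^ 2 - 4 := by nlinarith
  have h1 : (A - B) ^ 2 * (A + B) ^ 2 ≤ d ^ 2 * ((A + B) ^ 2 - 4) := by
    calc (A - B) ^ 2 * (A + B) ^ 2 = (A ^ 2 - B ^ 2) ^ 2 := by ring
      _ = (x - y) ^ 2 * (x + y) ^ 2 := by rw [hA, hB]; ring
      _ ≤ d ^ 2 * ((A + B) ^ 2 - 4) := by gcongr
  -- By the parallelogram law `(A + B)² - 4M² = d² - (A - B)²`, and `h1` bounds the subtracted term.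
  -- Factoring the difference of squares will bring out the convexity gap.
  have h2 : 4 * d ^ 2 ≤ (A + B) ^ 2 * ((A + B) ^ 2 - 4 * M ^ 2) := by
    rw [h4M]; linear_combination h1
  have h3 : 0 ≤ (A + B) ^ 2 - 4 * M ^ 2 := by
    by_contra hcon
    have := mul_neg_of_pos_of_neg (show 0 < (A + B) ^ 2 by positivity) (not_le.1 hcon)
    linarith [sq_nonneg d]
  have h4 : 2 * M ≤ A + B :=
    abs_le_of_sq_le_sq' (by linarith [mul_pow 2 M 2]) (by positivity) |>.2
  refine ⟨by linarith, ?_⟩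
  have h5 : (A + B) ^ 2 - 4 * M ^ 2 ≤ 4 * ((A + B) / 2 - M) * (A + B) := by
    have : (A + B) ^ 2 - 4 * M ^ 2 = (A + B - 2 * M) * (A + B + 2 * M) := by ring
    rw [this, show 4 * ((A + B) / 2 - M) * (A + B) = (A + B - 2 * M) * (2 * (A + B)) by ring]
    exact mul_le_mul_of_nonneg_left (by linarith) (by linarith)
  have h6 := mul_le_mul_of_nonneg_left h5 (show 0 ≤ (A + B) ^ 2 by positivity)
  linear_combination (1 / 4) * h2 + (1 / 4) * h6

/-- With gap `G` and sum `s`, the quadratic bound reads `‖a - b‖² ≤ (l³G)(l⁻¹s)³`; fourth roots and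
`PQ³ ≤ (P + Q)⁴` make it linear in `G` and `s`, so it can be integrated. The parameter `l` trades a
small gap against a merely bounded sum. -/
lemma sqrt_norm_sub_le_regNorm_gap (a b : H) {l : ℝ} (hl : 0 < l) :
    √‖a - b‖ ≤ l ^ 3 * ((regNorm a + regNorm b) / 2 - regNorm ((1 / 2 : ℝ) • (a + b)))
      + l⁻¹ * (regNorm a + regNorm b) := by
  obtain ⟨h0, h1⟩ := norm_sub_sq_le_regNorm_gap a b
  have hs : 0 ≤ regNorm a + regNorm b := by linarith [one_le_regNorm a, one_le_regNorm b]
  set G := (regNorm a + regNorm b) / 2 - regNorm ((1 / 2 : ℝ) • (a + b))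
  set s := regNorm a + regNorm b
  have hP : 0 ≤ l ^ 3 * G := by positivity
  have hQ : 0 ≤ l⁻¹ * s := by positivity
  refine le_of_pow_le_pow_left₀ (n := 4) (by norm_num) (by positivity) ?_
  calc √‖a - b‖ ^ 4 = (√‖a - b‖ ^ 2) ^ 2 := by ring
    _ = ‖a - b‖ ^ 2 := by rw [Real.sq_sqrt (norm_nonneg _)]
    _ ≤ G * s ^ 3 := h1
    _ = (l ^ 3 * G) * (l⁻¹ * s) ^ 3 := by field_simp
    _ ≤ (l ^ 3 * G + l⁻¹ * s) * (l ^ 3 * G + l⁻¹ * s) ^ 3 := by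
        gcongr
        · linarith
        · linarith
    _ = _ := by ring

/-- A decreasing sequence of nonempty midpoint-convex sets of functions that is bounded in `L¹`
has a sequence of members which converges almost everywhere. -/
theorem exists_mem_ae_tendsto_of_antitone [CompleteSpace H] [IsFiniteMeasure μ]
    {K : ℕ → Set (α → H)} (hanti : Antitone K) (hne : ∀ k, (K k).Nonempty)
    (hmid : ∀ k, ∀ v ∈ K k, ∀ w ∈ K k, (1 / 2 : ℝ) • (v + w) ∈ K k)
    (hint : ∀ v ∈ K 0, Integrable v μ) {C : ℝ} (hC : ∀ v ∈ K 0, ∫ x, ‖v x‖ ∂μ ≤ C) :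
    ∃ v : ℕ → α → H, (∀ k, v k ∈ K k) ∧
      ∀ᵐ x ∂μ, ∃ a, Tendsto (fun k => v k x) atTop (𝓝 a) := by
  have hreg : ∀ v ∈ K 0, Integrable (fun x => regNorm (v x)) μ := by
    intro v hv
    refine ((integrable_const (1 : ℝ)).add (hint v hv).norm).mono'
      (continuous_regNorm.comp_aestronglyMeasurable (hint v hv).1) (Eventually.of_forall fun x => ?_)
    rw [Real.norm_of_nonneg (by linarith [one_le_regNorm (v x)])]
    exact regNorm_le _
  set Φ : (α → H) → ℝ := fun v => ∫ x, regNorm (v x) ∂μ with hΦ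
  have hΦ0 : ∀ v, 0 ≤ Φ v := fun v =>
    integral_nonneg fun x => zero_le_one.trans (one_le_regNorm (v x))
  set D : ℝ := μ.real univ + C with hD
  have hΦD : ∀ v ∈ K 0, Φ v ≤ D := by
    intro v hv
    calc Φ v ≤ ∫ x, (1 + ‖v x‖) ∂μ :=
          integral_mono (hreg v hv) ((integrable_const (1 : ℝ)).add (hint v hv).norm)
            fun x => regNorm_le _
      _ = μ.real univ + ∫ x, ‖v x‖ ∂μ := by
          rw [integral_add (integrable_const _) (hint v hv).norm]; simp
      _ ≤ D := by rw [hD]; gcongr; exact hC v hv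
  have hK0 : ∀ k, K k ⊆ K 0 := fun k => hanti (Nat.zero_le k)
  have hbdd : ∀ k, BddBelow (Φ '' K k) := fun k => ⟨0, by rintro _ ⟨v, _, rfl⟩; exact hΦ0 v⟩
  set s : ℕ → ℝ := fun k => sInf (Φ '' K k) with hs
  have hsmono : Monotone s := fun i j hij =>
    csInf_le_csInf (hbdd i) ((hne j).image _) (image_mono (hanti hij))
  have hsle : ∀ k, ∀ v ∈ K k, s k ≤ Φ v := fun k v hv => csInf_le (hbdd k) ⟨v, hv, rfl⟩
  have hsbdd : BddAbove (range s) := by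
    refine ⟨D, ?_⟩
    rintro _ ⟨k, rfl⟩
    obtain ⟨v, hv⟩ := hne k
    exact (hsle k v hv).trans (hΦD v (hK0 k hv))
  set L := ⨆ k, s k with hL
  have hslim : Tendsto s atTop (𝓝 L) := tendsto_atTop_ciSup hsmono hsbdd
  have hε : ∀ k : ℕ, (0 : ℝ) < (1 / 16) ^ k := fun k => by positivity
  -- Along `φ` the infima of `Φ` over the sets are within `16⁻ᵏ` of their supremum `L`.
  obtain ⟨φ, hφ, hφs⟩ := extraction_forall_of_eventually
    (P := fun k j => L - (1 / 16) ^ k < s j)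
    (fun k => eventually_atTop.1 (hslim.eventually_const_lt (sub_lt_self L (hε k)))
      |> eventually_atTop.2)
  have hchoose : ∀ k, ∃ v ∈ K (φ k), Φ v < s (φ k) + (1 / 16) ^ k := by
    intro k
    obtain ⟨_, ⟨v, hv, rfl⟩, h⟩ := exists_lt_of_csInf_lt ((hne (φ k)).image Φ)
      (lt_add_of_pos_right _ (hε k) : s (φ k) < s (φ k) + (1 / 16) ^ k)
    exact ⟨v, hv, h⟩
  choose v hv hvΦ using hchoose
  have hv0 : ∀ k, v k ∈ K 0 := fun k => hK0 _ (hv k)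
  refine ⟨v, fun k => hanti (hφ.id_le k) (hv k), ?_⟩
  -- Both members have `Φ < L + 16⁻ᵏ`, while their midpoint lies in `K (φ k)` and so has `Φ > L -
  -- 16⁻ᵏ`.
  have hgap : ∀ k, (Φ (v k) + Φ (v (k + 1))) / 2 - Φ ((1 / 2 : ℝ) • (v k + v (k + 1)))
      ≤ 2 * (1 / 16) ^ k := by
    intro k
    have h1 := hvΦ k
    have h2 := hvΦ (k + 1)
    have h3 := hsle _ _ (hmid _ _ (hv k) _ (hanti (hφ.monotone (Nat.le_succ k)) (hv (k + 1))))
    have h4 := hφs k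
    have h5 : s (φ k) ≤ L := le_ciSup hsbdd _
    have h6 : s (φ (k + 1)) ≤ L := le_ciSup hsbdd _
    have h7 : (1 / 16 : ℝ) ^ (k + 1) ≤ (1 / 16) ^ k :=
      pow_le_pow_of_le_one (by norm_num) (by norm_num) (Nat.le_succ k)
    linarith
  have hmidint : ∀ k, Integrable (fun x => regNorm ((1 / 2 : ℝ) • (v k x + v (k + 1) x))) μ :=
    fun k => hreg _ (hmid 0 _ (hv0 k) _ (hv0 (k + 1)))
  have hgapint : ∀ k, Integrable (fun x => (regNorm (v k x) + regNorm (v (k + 1) x)) / 2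
      - regNorm ((1 / 2 : ℝ) • (v k x + v (k + 1) x))) μ := fun k =>
    (((hreg _ (hv0 k)).add (hreg _ (hv0 (k + 1)))).div_const 2).sub (hmidint k)
  have hsumint : ∀ k, Integrable (fun x => regNorm (v k x) + regNorm (v (k + 1) x)) μ := fun k =>
    (hreg _ (hv0 k)).add (hreg _ (hv0 (k + 1)))
  have hbd : ∀ k, Integrable (fun x => ((2 : ℝ) ^ k) ^ 3 *
      ((regNorm (v k x) + regNorm (v (k + 1) x)) / 2
        - regNorm ((1 / 2 : ℝ) • (v k x + v (k + 1) x)))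
      + ((2 : ℝ) ^ k)⁻¹ * (regNorm (v k x) + regNorm (v (k + 1) x))) μ := fun k =>
    ((hgapint k).const_mul _).add ((hsumint k).const_mul _)
  have hsq : ∀ k, Integrable (fun x => √‖v k x - v (k + 1) x‖) μ := fun k => by
    refine (hbd k).mono' (Real.continuous_sqrt.comp_aestronglyMeasurable
      ((hint _ (hv0 k)).sub (hint _ (hv0 (k + 1)))).1.norm) (Eventually.of_forall fun x => ?_)
    rw [Real.norm_of_nonneg (Real.sqrt_nonneg _)]
    exact sqrt_norm_sub_le_regNorm_gap _ _ (by positivity)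
  -- With `l = 2ᵏ` the gap term is `8ᵏ · 2 · 16⁻ᵏ` and the other is `2⁻ᵏ · 2D`: this is why `16` was
  -- the rate.
  refine ae_exists_tendsto_of_summable_integral_sqrt
    (b := fun k => (2 + 2 * D) * (1 / 2) ^ k)
    ((summable_geometric_of_lt_one (by norm_num) (by norm_num)).mul_left _) hsq fun k => ?_
  calc ∫ x, √‖v k x - v (k + 1) x‖ ∂μ ≤ _ :=
        integral_mono (hsq k) (hbd k) fun x =>
          sqrt_norm_sub_le_regNorm_gap _ _ (l := 2 ^ k) (by positivity)
    _ = (2 ^ k) ^ 3 * ((Φ (v k) + Φ (v (k + 1))) / 2 - Φ ((1 / 2 : ℝ) • (v k + v (k + 1))))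
        + (2 ^ k)⁻¹ * (Φ (v k) + Φ (v (k + 1))) := by
        rw [integral_add ((hgapint k).const_mul _) ((hsumint k).const_mul _),
          integral_const_mul, integral_const_mul,
          integral_sub ((hsumint k).div_const 2) (hmidint k),
          integral_div, integral_add (hreg _ (hv0 k)) (hreg _ (hv0 (k + 1)))]
        rfl
    _ ≤ (2 ^ k) ^ 3 * (2 * (1 / 16) ^ k) + (2 ^ k)⁻¹ * (D + D) := by
        gcongr
        · exact hgap k
        · exact hΦD _ (hv0 k)
        · exact hΦD _ (hv0 (k + 1))
    _ = (2 + 2 * D) * (1 / 2) ^ k := by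
        have h1 : ((2 : ℝ) ^ k) ^ 3 * (1 / 16) ^ k = (1 / 2) ^ k := by
          rw [← pow_mul, mul_comm k 3, pow_mul, ← mul_pow]; norm_num
        have h2 : ((2 : ℝ) ^ k)⁻¹ = (1 / 2) ^ k := by rw [← inv_pow]; norm_num
        rw [h2]
        linear_combination 2 * h1

end Selection

/-! ### Poincaré inequality on the whole space by telescoping shifts. -/

section Poincare

variable {E F : Type*} [NormedAddCommGroup E] [NormedSpace ℝ E] [FiniteDimensional ℝ E]
  [MeasurableSpace E] [BorelSpace E] {ν : Measure E} [ν.IsAddHaarMeasure]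
  [NormedAddCommGroup F]

omit [NormedSpace ℝ E] [FiniteDimensional ℝ E] in
/-- A function supported in a bounded set is controlled by its difference quotient along any
shift that leaves the set after finitely many steps. -/
lemma lintegral_enorm_rpow_le_shift {Ω : Set E} {w : E → F} {p : ℝ} (hp : 1 ≤ p)
    (hw : StronglyMeasurable w) (hsupp : ∀ x ∉ Ω, w x = 0) (z : E) (M : ℕ)
    (hM : ∀ x ∈ Ω, x + M • z ∉ Ω) :
    ∫⁻ x, ‖w x‖ₑ ^ p ∂ν ≤ (M : ENNReal) ^ p * ∫⁻ x, ‖w (x + z) - w x‖ₑ ^ p ∂ν := by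
  have hp0 : 0 < p := by linarith
  have hpt : ∀ x, ‖w x‖ₑ ^ p ≤
      (M : ENNReal) ^ (p - 1) * ∑ k ∈ Finset.range M, ‖w (x + k • z + z) - w (x + k • z)‖ₑ ^ p := by
    intro x
    by_cases hx : x ∈ Ω
    -- The sum telescopes from `w x` to `w (x + M • z)`, which vanishes since that point is outside
    -- `Ω`.
    · have htel : ∑ k ∈ Finset.range M, (w (x + k • z + z) - w (x + k • z)) = - w x := by
        have := Finset.sum_range_sub (fun k : ℕ => w (x + k • z)) M
        simp only [succ_nsmul, ← add_assoc] at this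
        rw [this, hsupp _ (hM x hx)]
        simp
      have h1 : ‖w x‖ₑ ≤ ∑ k ∈ Finset.range M, ‖w (x + k • z + z) - w (x + k • z)‖ₑ := by
        rw [← enorm_neg, ← htel]
        exact enorm_sum_le _ _
      calc ‖w x‖ₑ ^ p ≤ (∑ k ∈ Finset.range M, ‖w (x + k • z + z) - w (x + k • z)‖ₑ) ^ p := by
            gcongr
        _ ≤ _ := by
            have := ENNReal.rpow_sum_le_const_mul_sum_rpow (Finset.range M)
              (fun k => ‖w (x + k • z + z) - w (x + k • z)‖ₑ) hp
            simpa using this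
    · rw [hsupp x hx]; simp [hp0]
  have hmeas : Measurable fun x => ‖w (x + z) - w x‖ₑ ^ p :=
    (((hw.comp_measurable (measurable_add_const z)).sub hw).enorm).pow_const p
  have hmeas' : ∀ k : ℕ, Measurable fun x => ‖w (x + k • z + z) - w (x + k • z)‖ₑ ^ p :=
    fun k => hmeas.comp (measurable_add_const (k • z))
  calc ∫⁻ x, ‖w x‖ₑ ^ p ∂ν
      ≤ ∫⁻ x, (M : ENNReal) ^ (p - 1) *
          ∑ k ∈ Finset.range M, ‖w (x + k • z + z) - w (x + k • z)‖ₑ ^ p ∂ν := lintegral_mono hpt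
    _ = (M : ENNReal) ^ (p - 1) *
          ∑ k ∈ Finset.range M, ∫⁻ x, ‖w (x + k • z + z) - w (x + k • z)‖ₑ ^ p ∂ν := by
        rw [lintegral_const_mul _ (Finset.measurable_fun_sum _ fun k _ => hmeas' k),
          lintegral_finsetSum _ fun k _ => hmeas' k]
    _ = (M : ENNReal) ^ (p - 1) * (M * ∫⁻ x, ‖w (x + z) - w x‖ₑ ^ p ∂ν) := by
        congr 1
        have : ∀ k : ℕ, ∫⁻ x, ‖w (x + k • z + z) - w (x + k • z)‖ₑ ^ p ∂ν
            = ∫⁻ x, ‖w (x + z) - w x‖ₑ ^ p ∂ν := fun k =>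
          lintegral_add_right_eq_self (fun x => ‖w (x + z) - w x‖ₑ ^ p) (k • z)
        simp [this]
    _ = _ := by
        rw [← mul_assoc]
        congr 1
        rcases Nat.eq_zero_or_pos M with rfl | hM0
        · simp [hp0]
        · have h0 : (M : ENNReal) ≠ 0 := by exact_mod_cast hM0.ne'
          nth_rewrite 2 [← ENNReal.rpow_one (M : ENNReal)]
          rw [← ENNReal.rpow_add _ _ h0 (ENNReal.natCast_ne_top M)]
          simp

/-- Nonlocal Poincaré inequality on the whole space for functions supported in a bounded set. -/
theorem exists_nonlocal_poincare [Nontrivial E] {Ω : Set E} (hΩ : MeasurableSet Ω)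
    (hb : Bornology.IsBounded Ω) {δ : ℝ} (hδ : 0 < δ) {p : ℝ} (hp : 1 ≤ p) :
    ∃ C : ENNReal, C ≠ ⊤ ∧ ∀ w : E → F, StronglyMeasurable w → (∀ x ∉ Ω, w x = 0) →
      ∫⁻ x, ‖w x‖ₑ ^ p ∂ν ≤ C * ∫⁻ x, ∫⁻ y,
        Ω.indicator (fun _ => (Metric.ball x δ).indicator (fun y => ‖w y - w x‖ₑ ^ p) y) x ∂ν ∂ν := by
  obtain ⟨R, hR⟩ := hb.subset_ball (0 : E)
  -- Shifts in the annulus `T` are shorter than `δ`, hence seen by the kernel, and longer than `δ /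
  -- 2`, so `M` of them move a point by more than `2R` and out of `Ω`. Nontriviality of `E` makes
  -- `T` nonempty.
  obtain ⟨M, hM⟩ := exists_nat_gt (4 * R / δ)
  set T : Set E := Metric.ball 0 δ \ Metric.closedBall 0 (δ / 2) with hT
  have hTm : MeasurableSet T := measurableSet_ball.diff measurableSet_closedBall
  have hTo : IsOpen T := Metric.isOpen_ball.sdiff Metric.isClosed_closedBall
  have hTne : T.Nonempty := by
    obtain ⟨e, he⟩ := exists_norm_eq E (show (0 : ℝ) ≤ 3 / 4 * δ by positivity)
    exact ⟨e, by simp [he]; linarith, by simp [he]; linarith⟩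
  have hT0 : ν T ≠ 0 := (hTo.measure_pos ν hTne).ne'
  have hTtop : ν T ≠ ⊤ :=
    ((measure_mono sdiff_subset).trans_lt (measure_ball_lt_top (x := (0 : E)) (r := δ))).ne
  refine ⟨(ν T)⁻¹ * (M ^ p * 2), ?_, fun w hw hsupp => ?_⟩
  · exact ENNReal.mul_ne_top (ENNReal.inv_ne_top.2 hT0) (ENNReal.mul_ne_top
      (ENNReal.rpow_ne_top_of_nonneg (by linarith) (ENNReal.natCast_ne_top M)) (by simp))
  have hp0 : 0 < p := by linarith
  set k : E → E → ENNReal := fun x y =>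
    Ω.indicator (fun _ => (Metric.ball x δ).indicator (fun y => ‖w y - w x‖ₑ ^ p) y) x with hk
  have hkm : Measurable (Function.uncurry k) := by
    have h1 : Function.uncurry k = ({a : E × E | a.1 ∈ Ω} ∩ {a : E × E | dist a.2 a.1 < δ}).indicator
        (fun a => ‖w a.2 - w a.1‖ₑ ^ p) := by
      funext ⟨x, y⟩
      by_cases hx : x ∈ Ω <;> by_cases hy : dist y x < δ <;>
        simp [hk, indicator, hx, hy, Function.uncurry]
    rw [h1]
    refine Measurable.indicator ?_ ((measurable_fst hΩ).inter
      (measurableSet_lt (measurable_snd.dist measurable_fst) measurable_const))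
    exact (((hw.comp_measurable measurable_snd).sub
      (hw.comp_measurable measurable_fst)).enorm).pow_const p
  set J := ∫⁻ x, ∫⁻ y, k x y ∂ν ∂ν with hJ
  have hleave : ∀ z ∈ T, ∀ x ∈ Ω, x + M • z ∉ Ω := by
    intro z hz x hx hx'
    have h1 : ‖x‖ < R := by simpa using hR hx
    have h2 : ‖x + M • z‖ < R := by simpa using hR hx'
    have h3 : δ / 2 < ‖z‖ := by simpa using hz.2
    have h4 : ‖M • z‖ < 2 * R := by
      calc ‖M • z‖ = ‖(x + M • z) - x‖ := by congr 1; abel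
        _ ≤ ‖x + M • z‖ + ‖x‖ := norm_sub_le _ _
        _ < 2 * R := by linarith
    rw [← Nat.cast_smul_eq_nsmul ℝ, norm_smul, Real.norm_natCast] at h4
    rw [div_lt_iff₀ hδ] at hM
    have : (M : ℝ) * (δ / 2) ≤ M * ‖z‖ := by gcongr
    linarith
  -- The kernel requires its first argument to lie in `Ω`; either endpoint may be the one in `Ω`,
  -- which costs the factor `2` in the constant.
  have hG : ∀ z ∈ T, ∀ x, ‖w (x + z) - w x‖ₑ ^ p ≤ k x (x + z) + k (x + z) x := by
    intro z hz x
    have hzd : ‖z‖ < δ := by simpa using hz.1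
    by_cases hx : x ∈ Ω
    · refine le_add_right ?_
      simp [hk, hx, hzd]
    · by_cases hxz : x + z ∈ Ω
      · refine le_add_left ?_
        simp only [hk, indicator_of_mem hxz]
        rw [indicator_of_mem (by simpa [dist_eq_norm] using hzd), ← enorm_neg, neg_sub]
      · simp [hsupp _ hx, hsupp _ hxz, hp0]
  have hm1 : Measurable fun a : E × E => k a.2 (a.2 + a.1) :=
    hkm.comp (measurable_snd.prodMk (measurable_snd.add measurable_fst))
  have hm3 : Measurable fun a : E × E => k a.2 (a.2 - a.1) :=
    hkm.comp (measurable_snd.prodMk (measurable_snd.sub measurable_fst))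
  have hJ1 : ∫⁻ z, ∫⁻ x, k x (x + z) ∂ν ∂ν = J := by
    rw [lintegral_lintegral_swap hm1.aemeasurable, hJ]
    exact lintegral_congr fun x => lintegral_add_left_eq_self (fun y => k x y) x
  have hJ2 : ∫⁻ z, ∫⁻ x, k (x + z) x ∂ν ∂ν = J := by
    have : ∀ z, ∫⁻ x, k (x + z) x ∂ν = ∫⁻ x, k x (x - z) ∂ν := fun z => by
      rw [← lintegral_add_right_eq_self (fun x => k x (x - z)) z]
      simp
    simp_rw [this]
    rw [lintegral_lintegral_swap hm3.aemeasurable, hJ]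
    exact lintegral_congr fun x => lintegral_sub_left_eq_self (fun y => k x y) x
  have hmain : ν T * ∫⁻ x, ‖w x‖ₑ ^ p ∂ν ≤ M ^ p * 2 * J := by
    calc ν T * ∫⁻ x, ‖w x‖ₑ ^ p ∂ν = ∫⁻ _ in T, ∫⁻ x, ‖w x‖ₑ ^ p ∂ν ∂ν := by
          rw [lintegral_const, Measure.restrict_apply_univ, mul_comm]
      _ ≤ ∫⁻ z in T, M ^ p * ∫⁻ x, (k x (x + z) + k (x + z) x) ∂ν ∂ν := by
          refine setLIntegral_mono' hTm fun z hz => ?_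
          refine (lintegral_enorm_rpow_le_shift hp hw hsupp z M (hleave z hz)).trans ?_
          gcongr with x
          exact hG z hz x
      _ ≤ ∫⁻ z, M ^ p * ∫⁻ x, (k x (x + z) + k (x + z) x) ∂ν ∂ν := setLIntegral_le_lintegral _ _
      _ = M ^ p * (J + J) := by
          have hadd : ∀ z, ∫⁻ x, (k x (x + z) + k (x + z) x) ∂ν
              = ∫⁻ x, k x (x + z) ∂ν + ∫⁻ x, k (x + z) x ∂ν := fun z =>
            lintegral_add_left (hm1.comp measurable_prodMk_left) _
          simp_rw [hadd]
          have hm1' : Measurable fun z => ∫⁻ x, k x (x + z) ∂ν := hm1.lintegral_prod_right'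
          rw [lintegral_const_mul' _ _ (ENNReal.rpow_ne_top_of_nonneg hp0.le
            (ENNReal.natCast_ne_top M)), lintegral_add_left hm1', hJ1, hJ2]
      _ = M ^ p * 2 * J := by ring
  rw [mul_assoc, ← ENNReal.mul_le_iff_le_inv hT0 hTtop]
  exact hmain

end Poincare

/-! ### The weighted nonlocal spaces and their Poincaré inequality. -/

section Spaces

variable {n N : ℕ} {S Ω Γ : Set (EuclideanSpace ℝ (Fin n))} {p q : ℝ}
  {β : EuclideanSpace ℝ (Fin n) → EuclideanSpace ℝ (Fin n) → ℝ}

lemma volume_restrict_prod_self (S : Set (EuclideanSpace ℝ (Fin n))) :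
    (volume.restrict (S ×ˢ S) : Measure (EuclideanSpace ℝ (Fin n) × EuclideanSpace ℝ (Fin n)))
      = (volume.restrict S).prod (volume.restrict S) := by
  rw [Measure.prod_restrict, Measure.volume_eq_prod]

lemma ae_prod_self_of_ae {P : EuclideanSpace ℝ (Fin n) → Prop}
    (h : ∀ᵐ x ∂(volume.restrict S), P x) :
    ∀ᵐ w ∂(volume.restrict (S ×ˢ S)), P w.1 ∧ P w.2 := by
  rw [volume_restrict_prod_self]
  exact (Measure.quasiMeasurePreserving_fst.ae h).and (Measure.quasiMeasurePreserving_snd.ae h)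

lemma aestronglyMeasurable_comp_fst {F : Type*} [TopologicalSpace F]
    {u : EuclideanSpace ℝ (Fin n) → F} (hu : AEStronglyMeasurable u (volume.restrict S)) :
    AEStronglyMeasurable
      (fun w : EuclideanSpace ℝ (Fin n) × EuclideanSpace ℝ (Fin n) => u w.1)
      (volume.restrict (S ×ˢ S)) := by
  rw [volume_restrict_prod_self]
  exact hu.comp_fst

lemma aestronglyMeasurable_hatDiff {u : EuclideanSpace ℝ (Fin n) → EuclideanSpace ℝ (Fin N)}
    (hu : AEStronglyMeasurable u (volume.restrict S)) :
    AEStronglyMeasurable (hatDiff u) (volume.restrict (S ×ˢ S)) := by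
  rw [volume_restrict_prod_self]
  exact hu.comp_snd.sub hu.comp_fst

/-- Integrability sees only the norm, so `|β|` can be replaced by `β` without a sign condition;
measurability of `hatDiff u` follows from that of `u`. -/
lemma mem_nonlocalW_iff (hp : 0 < p)
    (hβ : AEMeasurable (pairKernel β) (volume.restrict (S ×ˢ S)))
    {u : EuclideanSpace ℝ (Fin n) → EuclideanSpace ℝ (Fin N)} :
    u ∈ nonlocalW N S p β ↔ AEStronglyMeasurable u (volume.restrict S) ∧
      Integrable (fun x => ‖u x‖ ^ p) (volume.restrict S) ∧
      Integrable (fun w => pairKernel β w * ‖hatDiff u w‖ ^ p) (volume.restrict (S ×ˢ S)) := by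
  have hp1 : ENNReal.ofReal p ≠ 0 := by simpa using hp
  have key : ∀ h : AEStronglyMeasurable u (volume.restrict S),
      MemLp u (ENNReal.ofReal p) (volume.restrict S)
        ↔ Integrable (fun x => ‖u x‖ ^ p) (volume.restrict S) := fun h => by
    rw [← integrable_norm_rpow_iff h hp1 ENNReal.ofReal_ne_top, ENNReal.toReal_ofReal hp.le]
  have key2 : AEStronglyMeasurable u (volume.restrict S) →
      ((∫⁻ w in S ×ˢ S, ENNReal.ofReal (|pairKernel β w| * ‖hatDiff u w‖ ^ p)) < ⊤
        ↔ Integrable (fun w => pairKernel β w * ‖hatDiff u w‖ ^ p)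
          (volume.restrict (S ×ˢ S))) := fun h => by
    have hm : AEStronglyMeasurable (fun w => pairKernel β w * ‖hatDiff u w‖ ^ p)
        (volume.restrict (S ×ˢ S)) :=
      (hβ.mul ((aestronglyMeasurable_hatDiff h).norm.aemeasurable.pow_const p)).aestronglyMeasurable
    rw [Integrable, and_iff_right hm, hasFiniteIntegral_iff_norm]
    refine iff_of_eq (congrArg (· < ⊤) (lintegral_congr fun w => ?_))
    rw [norm_mul, Real.norm_eq_abs, Real.norm_of_nonneg (by positivity : 0 ≤ ‖hatDiff u w‖ ^ p)]
  constructor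
  · rintro ⟨h1, -, h3⟩
    exact ⟨h1.1, (key h1.1).1 h1, (key2 h1.1).1 h3⟩
  · rintro ⟨h1, h2, h3⟩
    exact ⟨(key h1).2 h2, aestronglyMeasurable_hatDiff h1, (key2 h1).2 h3⟩

lemma rpow_le_of_le_add {a b c : ℝ} (hp : 0 ≤ p) (ha : 0 ≤ a) (hb : 0 ≤ b) (hc : 0 ≤ c)
    (h : c ≤ a + b) : c ^ p ≤ 2 ^ p * (a ^ p + b ^ p) := by
  have hm : c ≤ 2 * max a b := by linarith [le_max_left a b, le_max_right a b]
  calc c ^ p ≤ (2 * max a b) ^ p := Real.rpow_le_rpow hc hm hp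
    _ = 2 ^ p * (max a b) ^ p := Real.mul_rpow (by norm_num) (le_max_of_le_left ha)
    _ ≤ _ := by
        gcongr
        rcases max_cases a b with h | h <;> rw [h.1]
        · linarith [Real.rpow_nonneg hb p]
        · linarith [Real.rpow_nonneg ha p]

/-- A function dominated by two members of `W^p_β` belongs to `W^p_β`, with bounds. -/
lemma nonlocalW_of_le_add (hp : 0 < p)
    (hβ : AEMeasurable (pairKernel β) (volume.restrict (S ×ˢ S)))
    (hβ0 : ∀ᵐ w ∂(volume.restrict (S ×ˢ S)), 0 ≤ pairKernel β w)
    {u a b : EuclideanSpace ℝ (Fin n) → EuclideanSpace ℝ (Fin N)}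
    (ha : a ∈ nonlocalW N S p β) (hb : b ∈ nonlocalW N S p β)
    (hu : AEStronglyMeasurable u (volume.restrict S))
    (h1 : ∀ x, ‖u x‖ ≤ ‖a x‖ + ‖b x‖)
    (h2 : ∀ w, ‖hatDiff u w‖ ≤ ‖hatDiff a w‖ + ‖hatDiff b w‖) :
    u ∈ nonlocalW N S p β ∧
    ∫ x in S, ‖u x‖ ^ p ≤ 2 ^ p * ((∫ x in S, ‖a x‖ ^ p) + ∫ x in S, ‖b x‖ ^ p) ∧
    ∫ w in S ×ˢ S, pairKernel β w * ‖hatDiff u w‖ ^ p ≤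
      2 ^ p * ((∫ w in S ×ˢ S, pairKernel β w * ‖hatDiff a w‖ ^ p)
        + ∫ w in S ×ˢ S, pairKernel β w * ‖hatDiff b w‖ ^ p) := by
  obtain ⟨-, ha2, ha3⟩ := (mem_nonlocalW_iff hp hβ).1 ha
  obtain ⟨-, hb2, hb3⟩ := (mem_nonlocalW_iff hp hβ).1 hb
  have i1 := (ha2.add hb2).const_mul (2 ^ p)
  have i2 := (ha3.add hb3).const_mul (2 ^ p)
  have le1 : ∀ x, ‖u x‖ ^ p ≤ 2 ^ p * (‖a x‖ ^ p + ‖b x‖ ^ p) := fun x =>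
    rpow_le_of_le_add hp.le (norm_nonneg _) (norm_nonneg _) (norm_nonneg _) (h1 x)
  have le2 : ∀ᵐ w ∂(volume.restrict (S ×ˢ S)), pairKernel β w * ‖hatDiff u w‖ ^ p ≤
      2 ^ p * (pairKernel β w * ‖hatDiff a w‖ ^ p + pairKernel β w * ‖hatDiff b w‖ ^ p) := by
    filter_upwards [hβ0] with w hw
    calc pairKernel β w * ‖hatDiff u w‖ ^ p
        ≤ pairKernel β w * (2 ^ p * (‖hatDiff a w‖ ^ p + ‖hatDiff b w‖ ^ p)) := by
          gcongr
          exact rpow_le_of_le_add hp.le (norm_nonneg _) (norm_nonneg _) (norm_nonneg _) (h2 w)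
      _ = _ := by ring
  have j1 : Integrable (fun x => ‖u x‖ ^ p) (volume.restrict S) := by
    refine i1.mono' (hu.norm.aemeasurable.pow_const p).aestronglyMeasurable
      (Eventually.of_forall fun x => ?_)
    rw [Real.norm_of_nonneg (by positivity)]
    exact le1 x
  have j2 : Integrable (fun w => pairKernel β w * ‖hatDiff u w‖ ^ p)
      (volume.restrict (S ×ˢ S)) := by
    refine i2.mono' (hβ.mul
      ((aestronglyMeasurable_hatDiff hu).norm.aemeasurable.pow_const p)).aestronglyMeasurable ?_
    filter_upwards [hβ0, le2] with w hw hle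
    rw [Real.norm_of_nonneg (by positivity)]
    exact hle
  refine ⟨(mem_nonlocalW_iff hp hβ).2 ⟨hu, j1, j2⟩, ?_, ?_⟩
  · rw [← integral_add ha2 hb2, ← integral_const_mul]
    exact integral_mono j1 i1 le1
  · rw [← integral_add ha3 hb3, ← integral_const_mul]
    exact integral_mono_ae j2 i2 le2

lemma nonlocalW_sub (hp : 0 < p)
    (hβ : AEMeasurable (pairKernel β) (volume.restrict (S ×ˢ S)))
    (hβ0 : ∀ᵐ w ∂(volume.restrict (S ×ˢ S)), 0 ≤ pairKernel β w)
    {a b : EuclideanSpace ℝ (Fin n) → EuclideanSpace ℝ (Fin N)}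
    (ha : a ∈ nonlocalW N S p β) (hb : b ∈ nonlocalW N S p β) :
    a - b ∈ nonlocalW N S p β ∧
    ∫ w in S ×ˢ S, pairKernel β w * ‖hatDiff (a - b) w‖ ^ p ≤
      2 ^ p * ((∫ w in S ×ˢ S, pairKernel β w * ‖hatDiff a w‖ ^ p)
        + ∫ w in S ×ˢ S, pairKernel β w * ‖hatDiff b w‖ ^ p) := by
  obtain ⟨h1, -, h3⟩ := nonlocalW_of_le_add hp hβ hβ0 ha hb (ha.1.1.sub hb.1.1)
    (fun x => norm_sub_le _ _) (fun w => by
      rw [show hatDiff (a - b) w = hatDiff a w - hatDiff b w by simp [hatDiff]; abel]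
      exact norm_sub_le _ _)
  exact ⟨h1, h3⟩

lemma hatDiff_midpoint (a b : EuclideanSpace ℝ (Fin n) → EuclideanSpace ℝ (Fin N))
    (w : EuclideanSpace ℝ (Fin n) × EuclideanSpace ℝ (Fin n)) :
    hatDiff ((1 / 2 : ℝ) • (a + b)) w = (1 / 2 : ℝ) • hatDiff a w + (1 / 2 : ℝ) • hatDiff b w := by
  simp only [hatDiff, Pi.smul_apply, Pi.add_apply]
  module

lemma norm_midpoint_le {F : Type*} [NormedAddCommGroup F] [NormedSpace ℝ F] (a b : F) :
    ‖(1 / 2 : ℝ) • a + (1 / 2 : ℝ) • b‖ ≤ ‖a‖ + ‖b‖ := by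
  refine (norm_add_le _ _).trans ?_
  rw [norm_smul, norm_smul]
  norm_num
  linarith [norm_nonneg a, norm_nonneg b]

lemma nonlocalW_midpoint (hp : 0 < p)
    (hβ : AEMeasurable (pairKernel β) (volume.restrict (S ×ˢ S)))
    (hβ0 : ∀ᵐ w ∂(volume.restrict (S ×ˢ S)), 0 ≤ pairKernel β w)
    {a b : EuclideanSpace ℝ (Fin n) → EuclideanSpace ℝ (Fin N)}
    (ha : a ∈ nonlocalW N S p β) (hb : b ∈ nonlocalW N S p β) :
    (1 / 2 : ℝ) • (a + b) ∈ nonlocalW N S p β :=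
  (nonlocalW_of_le_add hp hβ hβ0 ha hb ((ha.1.1.add hb.1.1).const_smul _)
    (fun x => by
      rw [Pi.smul_apply, Pi.add_apply, smul_add]
      exact norm_midpoint_le _ _)
    (fun w => by
      rw [hatDiff_midpoint]
      exact norm_midpoint_le _ _)).1

/-- The space is closed under subtraction, so only the condition on `Γ` remains to be checked for `v
- u₀`. -/
lemma mem_admissibleClass_iff (hp : 0 < p)
    (hβ : AEMeasurable (pairKernel β) (volume.restrict ((Ω ∪ Γ) ×ˢ (Ω ∪ Γ))))
    (hβ0 : ∀ᵐ w ∂(volume.restrict ((Ω ∪ Γ) ×ˢ (Ω ∪ Γ))), 0 ≤ pairKernel β w)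
    {u₀ v : EuclideanSpace ℝ (Fin n) → EuclideanSpace ℝ (Fin N)}
    (hu₀ : u₀ ∈ nonlocalW N (Ω ∪ Γ) p β) :
    v ∈ admissibleClass Ω Γ p β u₀ ↔
      v ∈ nonlocalW N (Ω ∪ Γ) p β ∧ ∀ᵐ x ∂(volume.restrict Γ), v x = u₀ x := by
  constructor
  · rintro ⟨h1, -, h3⟩
    exact ⟨h1, h3.mono fun x hx => sub_eq_zero.1 hx⟩
  · rintro ⟨h1, h3⟩
    exact ⟨h1, (nonlocalW_sub hp hβ hβ0 h1 hu₀).1, h3.mono fun x hx => sub_eq_zero.2 hx⟩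

/-- Nonlocal Poincaré inequality on `W^p_{β,0}`. -/
theorem exists_nonlocalWZero_poincare (hn : 1 ≤ n) (hΩ : IsOpen Ω)
    (hΩb : Bornology.IsBounded Ω) (hΓ : MeasurableSet Γ)
    {δ : ℝ} (hδ : 0 < δ) (hcollar : (⋃ x ∈ Ω, Metric.ball x δ) ⊆ Ω ∪ Γ) (hp : 1 ≤ p)
    (hβ : AEMeasurable (pairKernel β) (volume.restrict ((Ω ∪ Γ) ×ˢ (Ω ∪ Γ))))
    (hβ0 : ∀ᵐ w ∂(volume.restrict ((Ω ∪ Γ) ×ˢ (Ω ∪ Γ))), 0 ≤ pairKernel β w)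
    {C₀ : ℝ} (hC₀ : 0 < C₀)
    (hβ1 : ∀ᵐ w ∂(volume.restrict (Ω ×ˢ (Ω ∪ Γ))),
      C₀ * (Metric.ball w.1 δ).indicator (fun _ => (1 : ℝ)) w.2 ≤ pairKernel β w) :
    ∃ C : ℝ, 0 ≤ C ∧ ∀ v ∈ nonlocalWZero N Ω Γ p β,
      ∫ x in Ω ∪ Γ, ‖v x‖ ^ p ≤
        C * ∫ w in (Ω ∪ Γ) ×ˢ (Ω ∪ Γ), pairKernel β w * ‖hatDiff v w‖ ^ p := by
  have hp0 : 0 < p := by linarith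
  have : Nonempty (Fin n) := ⟨⟨0, hn⟩⟩
  have hSm : MeasurableSet (Ω ∪ Γ) := hΩ.measurableSet.union hΓ
  obtain ⟨C, hC, hPoin⟩ := exists_nonlocal_poincare
    (ν := (volume : Measure (EuclideanSpace ℝ (Fin n)))) (F := EuclideanSpace ℝ (Fin N))
    hΩ.measurableSet hΩb hδ hp
  refine ⟨C.toReal * C₀⁻¹, by positivity, fun v hv => ?_⟩
  obtain ⟨hvW, hv0⟩ := hv
  obtain ⟨hvm, hvY, hvX⟩ := (mem_nonlocalW_iff hp0 hβ).1 hvW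
  -- `Ω` and `Γ` may overlap. Since `v` vanishes a.e. on `Γ`, cutting off to `Ω \ Γ` changes it only
  -- on a null subset of `Ω ∪ Γ`, and extends it by zero.
  set w : EuclideanSpace ℝ (Fin n) → EuclideanSpace ℝ (Fin N) :=
    (Ω \ Γ).indicator (hvm.mk v) with hw
  have hwm : StronglyMeasurable w := hvm.stronglyMeasurable_mk.indicator (hΩ.measurableSet.diff hΓ)
  have hwv : ∀ᵐ x ∂(volume.restrict (Ω ∪ Γ)), w x = v x := by
    have h0 : ∀ᵐ x ∂(volume.restrict (Ω ∪ Γ)), x ∈ Γ → v x = 0 :=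
      ae_restrict_of_ae ((ae_restrict_iff' hΓ).1 hv0)
    filter_upwards [hvm.ae_eq_mk, h0, ae_restrict_mem hSm] with x hx hx0 hxS
    by_cases hxΓ : x ∈ Γ
    · simp [hw, hxΓ, hx0 hxΓ]
    · simp [hw, hxΓ, hxS.resolve_right hxΓ, hx]
  have hP := hPoin w hwm fun x hx => indicator_of_notMem (fun h => hx h.1) _
  have hL : ∫⁻ x in Ω ∪ Γ, ENNReal.ofReal (‖v x‖ ^ p) ≤ ∫⁻ x, ‖w x‖ₑ ^ p := by
    calc ∫⁻ x in Ω ∪ Γ, ENNReal.ofReal (‖v x‖ ^ p) = ∫⁻ x in Ω ∪ Γ, ‖w x‖ₑ ^ p := by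
          refine lintegral_congr_ae ?_
          filter_upwards [hwv] with x hx
          rw [hx, ← ENNReal.ofReal_rpow_of_nonneg (norm_nonneg _) hp0.le, ofReal_norm]
      _ ≤ _ := setLIntegral_le_lintegral _ _
  set D : EuclideanSpace ℝ (Fin n) × EuclideanSpace ℝ (Fin n) → ENNReal :=
    fun a => ENNReal.ofReal (C₀⁻¹ * (pairKernel β a * ‖hatDiff v a‖ ^ p)) with hD
  have hDm : AEMeasurable D (volume.restrict ((Ω ∪ Γ) ×ˢ (Ω ∪ Γ))) :=
    (hvX.1.aemeasurable.const_mul _).ennreal_ofReal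
  have hβ1' : ∀ᵐ a ∂(volume.restrict ((Ω ∪ Γ) ×ˢ (Ω ∪ Γ))), a.1 ∈ Ω → a.2 ∈ Ω ∪ Γ →
      C₀ * (Metric.ball a.1 δ).indicator (fun _ => (1 : ℝ)) a.2 ≤ pairKernel β a := by
    refine ae_restrict_of_ae ?_
    filter_upwards [(ae_restrict_iff' (hΩ.measurableSet.prod hSm)).1 hβ1] with a ha h1 h2
    exact ha ⟨h1, h2⟩
  have hR : ∫⁻ x, ∫⁻ y, Ω.indicator (fun _ => (Metric.ball x δ).indicator
      (fun y => ‖w y - w x‖ₑ ^ p) y) x ≤ ∫⁻ a in (Ω ∪ Γ) ×ˢ (Ω ∪ Γ), D a := by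
    have hle : ∀ᵐ a ∂(volume.restrict ((Ω ∪ Γ) ×ˢ (Ω ∪ Γ))),
        Ω.indicator (fun _ => (Metric.ball a.1 δ).indicator
          (fun y => ‖w y - w a.1‖ₑ ^ p) a.2) a.1 ≤ D a := by
      filter_upwards [hβ1', ae_prod_self_of_ae hwv,
        ae_restrict_mem (hSm.prod hSm)] with a ha1 ha2 ha3
      by_cases h1 : a.1 ∈ Ω
      · by_cases h2 : a.2 ∈ Metric.ball a.1 δ
        · have h := ha1 h1 ha3.2
          rw [indicator_of_mem h2, mul_one] at h
          rw [indicator_of_mem h1, indicator_of_mem h2, ha2.1, ha2.2, ← ofReal_norm,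
            ENNReal.ofReal_rpow_of_nonneg (norm_nonneg _) hp0.le]
          refine ENNReal.ofReal_le_ofReal ?_
          rw [← mul_assoc]
          refine le_mul_of_one_le_left (by positivity) ?_
          rw [inv_mul_eq_div, one_le_div hC₀]
          exact h
        · rw [indicator_of_mem h1, indicator_of_notMem h2]
          exact zero_le
      · rw [indicator_of_notMem h1]
        exact zero_le
    have hDm' := hDm
    rw [volume_restrict_prod_self] at hle hDm' ⊢
    rw [lintegral_prod _ hDm', ← lintegral_indicator hSm]
    refine lintegral_mono_ae ?_
    filter_upwards [(ae_restrict_iff' hSm).1 (Measure.ae_ae_of_ae_prod hle)] with x hx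
    by_cases hxΩ : x ∈ Ω
    · have hxS : x ∈ Ω ∪ Γ := Or.inl hxΩ
      rw [indicator_of_mem hxS, ← lintegral_indicator hSm]
      refine lintegral_mono_ae ?_
      filter_upwards [(ae_restrict_iff' hSm).1 (hx hxS)] with y hy
      by_cases hyS : y ∈ Ω ∪ Γ
      · rw [indicator_of_mem hyS]
        exact hy hyS
      -- The collar condition keeps the ball inside `Ω ∪ Γ`, so points outside contribute nothing.
      · have hyb : y ∉ Metric.ball x δ := fun h =>
          hyS (hcollar (mem_iUnion₂.2 ⟨x, hxΩ, h⟩))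
        simp [hyb]
    · simp [hxΩ]
  have hX0 : 0 ≤ᵐ[volume.restrict ((Ω ∪ Γ) ×ˢ (Ω ∪ Γ))]
      fun a => pairKernel β a * ‖hatDiff v a‖ ^ p := by
    filter_upwards [hβ0] with a ha
    exact mul_nonneg ha (by positivity)
  have hD' : ∫⁻ a in (Ω ∪ Γ) ×ˢ (Ω ∪ Γ), D a = ENNReal.ofReal (C₀⁻¹ *
      ∫ a in (Ω ∪ Γ) ×ˢ (Ω ∪ Γ), pairKernel β a * ‖hatDiff v a‖ ^ p) := by
    rw [← integral_const_mul, ofReal_integral_eq_lintegral_ofReal (hvX.const_mul _)]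
    filter_upwards [hX0] with a ha
    exact mul_nonneg (by positivity) ha
  have hfin := (hL.trans hP).trans (mul_le_mul_right hR C)
  rw [hD', ← ofReal_integral_eq_lintegral_ofReal hvY
    (Eventually.of_forall fun x => by positivity), ← ENNReal.ofReal_toReal hC,
    ← ENNReal.ofReal_mul ENNReal.toReal_nonneg, ← mul_assoc] at hfin
  exact (ENNReal.ofReal_le_ofReal_iff
    (mul_nonneg (by positivity) (integral_nonneg_of_ae hX0))).1 hfin

end Spaces

/-! ### Measurability, lower bound, convexity and continuity of the energy density. -/

section Energy

variable {n N : ℕ} {S : Set (EuclideanSpace ℝ (Fin n))} {p q : ℝ}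
  {f : EuclideanSpace ℝ (Fin n) → EuclideanSpace ℝ (Fin n) →
    EuclideanSpace ℝ (Fin N) → EuclideanSpace ℝ (Fin N) → ℝ}

lemma aemeasurable_energyDensity
    (hf_meas : ∀ u ξ : EuclideanSpace ℝ (Fin N),
      AEMeasurable (fun w : EuclideanSpace ℝ (Fin n) × EuclideanSpace ℝ (Fin n) =>
        f w.1 (w.2 - w.1) u ξ) (volume.restrict (S ×ˢ S)))
    (hf_cont : ∀ᵐ w ∂(volume.restrict (S ×ˢ S)),
      Continuous (fun a : EuclideanSpace ℝ (Fin N) × EuclideanSpace ℝ (Fin N) =>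
        f w.1 (w.2 - w.1) a.1 a.2))
    {v : EuclideanSpace ℝ (Fin n) → EuclideanSpace ℝ (Fin N)}
    (hv : AEStronglyMeasurable v (volume.restrict S)) :
    AEMeasurable (energyDensity f v) (volume.restrict (S ×ˢ S)) := by
  have h := aemeasurable_caratheodory
    (F := fun (w : EuclideanSpace ℝ (Fin n) × EuclideanSpace ℝ (Fin n))
      (a : EuclideanSpace ℝ (Fin N) × EuclideanSpace ℝ (Fin N)) =>
        f w.1 (w.2 - w.1) a.1 a.2) (fun a => hf_meas a.1 a.2) hf_cont
    ((aestronglyMeasurable_comp_fst hv).prodMk (aestronglyMeasurable_hatDiff hv))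
  exact h

/-- The coercivity bound after absorbing the term in `|u|^q` with Young's inequality. -/
lemma exists_energyDensity_lower_bound {α₁ α₂ α₃ : EuclideanSpace ℝ (Fin n) →
      EuclideanSpace ℝ (Fin n) → ℝ} (hq : 1 ≤ q) (hqp : q < p)
    (hα₂ : MemLp (pairKernel α₂) (ENNReal.ofReal (p / (p - q))) (volume.restrict (S ×ˢ S)))
    (hα₃ : MemLp (pairKernel α₃) 1 (volume.restrict (S ×ˢ S)))
    (hf_coer : ∀ᵐ w ∂(volume.restrict (S ×ˢ S)), ∀ u ξ : EuclideanSpace ℝ (Fin N),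
        pairKernel α₁ w * ‖ξ‖ ^ p + pairKernel α₂ w * ‖u‖ ^ q + pairKernel α₃ w
          ≤ f w.1 (w.2 - w.1) u ξ) {ε : ℝ} (hε : 0 < ε) :
    ∃ b : EuclideanSpace ℝ (Fin n) × EuclideanSpace ℝ (Fin n) → ℝ,
      Integrable b (volume.restrict (S ×ˢ S)) ∧
      ∀ᵐ w ∂(volume.restrict (S ×ˢ S)),
        ∀ v : EuclideanSpace ℝ (Fin n) → EuclideanSpace ℝ (Fin N),
          pairKernel α₁ w * ‖hatDiff v w‖ ^ p ≤ energyDensity f v w + (ε * ‖v w.1‖ ^ p + b w) := by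
  have hr : 0 < p / (p - q) := div_pos (by linarith) (by linarith)
  obtain ⟨C, -, hC⟩ := exists_young hq hqp hε
  -- The exponent is conjugate to `p / q`, exactly the integrability assumed of `α₂`. As the bound
  -- is pointwise, one null set serves all `v`.
  refine ⟨fun w => C * ‖pairKernel α₂ w‖ ^ (p / (p - q)) + ‖pairKernel α₃ w‖, ?_, ?_⟩
  · have h2 := hα₂.integrable_norm_rpow (by simpa using hr) ENNReal.ofReal_ne_top
    rw [ENNReal.toReal_ofReal hr.le] at h2
    exact (h2.const_mul C).add (memLp_one_iff_integrable.1 hα₃).norm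
  · filter_upwards [hf_coer] with w hw v
    have h1 := hw (v w.1) (hatDiff v w)
    have h2 := hC ‖pairKernel α₂ w‖ ‖v w.1‖ (norm_nonneg _) (norm_nonneg _)
    have h3 : -(‖pairKernel α₂ w‖ * ‖v w.1‖ ^ q) ≤ pairKernel α₂ w * ‖v w.1‖ ^ q := by
      rw [← neg_mul]
      gcongr
      exact neg_abs_le _
    have h4 : -‖pairKernel α₃ w‖ ≤ pairKernel α₃ w := neg_abs_le _
    simp only [energyDensity]
    linarith

lemma integrable_norm_rpow_comp_fst {v : EuclideanSpace ℝ (Fin n) → EuclideanSpace ℝ (Fin N)}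
    (hS : volume S ≠ ⊤) (hv : Integrable (fun x => ‖v x‖ ^ p) (volume.restrict S)) :
    Integrable (fun w : EuclideanSpace ℝ (Fin n) × EuclideanSpace ℝ (Fin n) => ‖v w.1‖ ^ p)
      (volume.restrict (S ×ˢ S)) ∧
    ∫ w in S ×ˢ S, ‖v w.1‖ ^ p = volume.real S * ∫ x in S, ‖v x‖ ^ p := by
  have : IsFiniteMeasure (volume.restrict S) := isFiniteMeasure_restrict.2 hS
  rw [volume_restrict_prod_self]
  refine ⟨hv.comp_fst _, ?_⟩
  rw [integral_fun_fst (fun x => ‖v x‖ ^ p)]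
  simp

lemma energyNeg_lt_top_of_le {v : EuclideanSpace ℝ (Fin n) → EuclideanSpace ℝ (Fin N)}
    {h : EuclideanSpace ℝ (Fin n) × EuclideanSpace ℝ (Fin n) → ℝ}
    (hint : Integrable h (volume.restrict (S ×ˢ S)))
    (hle : ∀ᵐ w ∂(volume.restrict (S ×ˢ S)), 0 ≤ energyDensity f v w + h w) :
    energyNeg S f v < ⊤ := by
  refine lt_of_le_of_lt (lintegral_mono_ae ?_) ((hasFiniteIntegral_iff_norm h).1 hint.2)
  filter_upwards [hle] with w hw
  exact ENNReal.ofReal_le_ofReal (by linarith [le_abs_self (h w), Real.norm_eq_abs (h w)])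

lemma energyDensity_midpoint_le {w : EuclideanSpace ℝ (Fin n) × EuclideanSpace ℝ (Fin n)}
    (h : ConvexOn ℝ univ (fun a : EuclideanSpace ℝ (Fin N) × EuclideanSpace ℝ (Fin N) =>
        f w.1 (w.2 - w.1) a.1 a.2))
    (a b : EuclideanSpace ℝ (Fin n) → EuclideanSpace ℝ (Fin N)) :
    energyDensity f ((1 / 2 : ℝ) • (a + b)) w ≤
      (energyDensity f a w + energyDensity f b w) / 2 := by
  have hmid := h.2
  have := hmid (mem_univ (a w.1, hatDiff a w)) (mem_univ (b w.1, hatDiff b w))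
    (show (0 : ℝ) ≤ 1 / 2 by norm_num) (show (0 : ℝ) ≤ 1 / 2 by norm_num) (by norm_num)
  simp only [energyDensity, hatDiff_midpoint]
  simp only [Prod.smul_mk, Prod.mk_add_mk, smul_eq_mul] at this
  rw [Pi.smul_apply, Pi.add_apply, smul_add]
  linarith

lemma tendsto_energyDensity {w : EuclideanSpace ℝ (Fin n) × EuclideanSpace ℝ (Fin n)}
    (hc : Continuous (fun a : EuclideanSpace ℝ (Fin N) × EuclideanSpace ℝ (Fin N) =>
        f w.1 (w.2 - w.1) a.1 a.2))
    {v : ℕ → EuclideanSpace ℝ (Fin n) → EuclideanSpace ℝ (Fin N)}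
    {u : EuclideanSpace ℝ (Fin n) → EuclideanSpace ℝ (Fin N)}
    (h1 : Tendsto (fun k => v k w.1) atTop (𝓝 (u w.1)))
    (h2 : Tendsto (fun k => v k w.2) atTop (𝓝 (u w.2))) :
    Tendsto (fun k => energyDensity f (v k) w) atTop (𝓝 (energyDensity f u w)) :=
  (hc.tendsto (u w.1, hatDiff u w)).comp (h1.prodMk_nhds (h2.sub h1))

end Energy

/-! ### Existence of a minimiser. -/

theorem theorem4p2 (n N : ℕ) (hn : 1 ≤ n)
    (Ω Γ : Set (EuclideanSpace ℝ (Fin n)))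
    (hΩ : IsOpen Ω) (hΩb : Bornology.IsBounded Ω)
    (hΓ : MeasurableSet Γ) (hΓb : Bornology.IsBounded Γ)
    -- the collar condition
    (δ : ℝ) (hδ : 0 < δ) (hcollar : (⋃ x ∈ Ω, Metric.ball x δ) ⊆ Ω ∪ Γ)
    (p q : ℝ) (hq : 1 ≤ q) (hqp : q < p)
    (f : EuclideanSpace ℝ (Fin n) → EuclideanSpace ℝ (Fin n) →
      EuclideanSpace ℝ (Fin N) → EuclideanSpace ℝ (Fin N) → ℝ)
    -- measurable in `(x, y)`, continuous and jointly convex in `(u, ξ)`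
    (hf_meas : ∀ u ξ : EuclideanSpace ℝ (Fin N),
      AEMeasurable (fun w : EuclideanSpace ℝ (Fin n) × EuclideanSpace ℝ (Fin n) =>
        f w.1 (w.2 - w.1) u ξ) (volume.restrict ((Ω ∪ Γ) ×ˢ (Ω ∪ Γ))))
    (hf_cont : ∀ᵐ w ∂(volume.restrict ((Ω ∪ Γ) ×ˢ (Ω ∪ Γ))),
      Continuous (fun a : EuclideanSpace ℝ (Fin N) × EuclideanSpace ℝ (Fin N) =>
        f w.1 (w.2 - w.1) a.1 a.2))
    (hf_conv : ∀ᵐ w ∂(volume.restrict ((Ω ∪ Γ) ×ˢ (Ω ∪ Γ))),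
      ConvexOn ℝ univ (fun a : EuclideanSpace ℝ (Fin N) × EuclideanSpace ℝ (Fin N) =>
        f w.1 (w.2 - w.1) a.1 a.2))
    -- the coefficients of the coercivity bound
    (α₁ α₂ α₃ : EuclideanSpace ℝ (Fin n) → EuclideanSpace ℝ (Fin n) → ℝ)
    (hα₁_meas : AEMeasurable (pairKernel α₁) (volume.restrict ((Ω ∪ Γ) ×ˢ (Ω ∪ Γ))))
    (hα₁_nonneg : ∀ᵐ w ∂(volume.restrict ((Ω ∪ Γ) ×ˢ (Ω ∪ Γ))), 0 ≤ pairKernel α₁ w)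
    (C₀ : ℝ) (hC₀ : 0 < C₀)
    (hα₁ : ∀ᵐ w ∂(volume.restrict (Ω ×ˢ (Ω ∪ Γ))),
      C₀ * (Metric.ball w.1 δ).indicator (fun _ => (1 : ℝ)) w.2 ≤ pairKernel α₁ w)
    (hα₂ : MemLp (pairKernel α₂) (ENNReal.ofReal (p / (p - q)))
      (volume.restrict ((Ω ∪ Γ) ×ˢ (Ω ∪ Γ))))
    (hα₃ : MemLp (pairKernel α₃) 1 (volume.restrict ((Ω ∪ Γ) ×ˢ (Ω ∪ Γ))))
    -- coercivity
    (hf_coer : ∀ᵐ w ∂(volume.restrict ((Ω ∪ Γ) ×ˢ (Ω ∪ Γ))),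
      ∀ u ξ : EuclideanSpace ℝ (Fin N),
        pairKernel α₁ w * ‖ξ‖ ^ p + pairKernel α₂ w * ‖u‖ ^ q + pairKernel α₃ w
          ≤ f w.1 (w.2 - w.1) u ξ)
    (u₀ : EuclideanSpace ℝ (Fin n) → EuclideanSpace ℝ (Fin N))
    (hu₀ : u₀ ∈ nonlocalW N (Ω ∪ Γ) p α₁)
    (hFu₀ : energy (Ω ∪ Γ) f u₀ < ⊤) :
    -- the functional is well defined on the admissible class, and attains its infimum there
    (∀ v ∈ admissibleClass Ω Γ p α₁ u₀, energyNeg (Ω ∪ Γ) f v < ⊤) ∧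
    ∃ u ∈ admissibleClass Ω Γ p α₁ u₀,
      energy (Ω ∪ Γ) f u = sInf (energy (Ω ∪ Γ) f '' admissibleClass Ω Γ p α₁ u₀) := by
  have hp : 1 < p := by linarith
  have hp0 : 0 < p := by linarith
  have hSm : MeasurableSet (Ω ∪ Γ) := hΩ.measurableSet.union hΓ
  have hSfin : volume (Ω ∪ Γ) ≠ ⊤ := (hΩb.union hΓb).measure_lt_top.ne
  obtain ⟨CP, hCP, hPoin⟩ := exists_nonlocalWZero_poincare (N := N) hn hΩ hΩb hΓ hδ hcollar hp.le
    hα₁_meas hα₁_nonneg hC₀ hα₁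
  set S : Set (EuclideanSpace ℝ (Fin n)) := Ω ∪ Γ with hS
  have : IsFiniteMeasure (volume.restrict S) := isFiniteMeasure_restrict.2 hSfin
  have hW := fun v : EuclideanSpace ℝ (Fin n) → EuclideanSpace ℝ (Fin N) =>
    (mem_nonlocalW_iff (u := v) hp0 hα₁_meas).1
  have hA := fun v : EuclideanSpace ℝ (Fin n) → EuclideanSpace ℝ (Fin N) =>
    mem_admissibleClass_iff (v := v) hp0 hα₁_meas hα₁_nonneg hu₀
  have hlow := fun (ε : ℝ) (hε : 0 < ε) => exists_energyDensity_lower_bound hq hqp hα₂ hα₃ hf_coer hε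
  have hem := fun (v : EuclideanSpace ℝ (Fin n) → EuclideanSpace ℝ (Fin N))
    (hv : v ∈ nonlocalW N S p α₁) => aemeasurable_energyDensity hf_meas hf_cont (hW v hv).1
  have hpos : ∀ v ∈ nonlocalW N S p α₁, 0 ≤ᵐ[volume.restrict (S ×ˢ S)]
      fun w => pairKernel α₁ w * ‖hatDiff v w‖ ^ p := fun v _ => by
    filter_upwards [hα₁_nonneg] with w hw
    exact mul_nonneg hw (by positivity)
  have hfst := fun (v : EuclideanSpace ℝ (Fin n) → EuclideanSpace ℝ (Fin N))
    (hv : v ∈ nonlocalW N S p α₁) => integrable_norm_rpow_comp_fst hSfin (hW v hv).2.1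
  have hneg : ∀ v ∈ nonlocalW N S p α₁, energyNeg S f v < ⊤ := by
    intro v hv
    obtain ⟨b, hb, hbf⟩ := hlow 1 one_pos
    refine energyNeg_lt_top_of_le (((hfst v hv).1.const_mul 1).add hb) ?_
    filter_upwards [hbf, hpos v hv] with w h1 h2
    exact h2.trans (h1 v)
  have hu₀A : u₀ ∈ admissibleClass Ω Γ p α₁ u₀ :=
    (hA u₀).2 ⟨hu₀, Eventually.of_forall fun _ => rfl⟩
  have hEint : ∀ v ∈ nonlocalW N S p α₁, energy S f v < ⊤ →
      Integrable (energyDensity f v) (volume.restrict (S ×ˢ S)) := fun v hv h =>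
    integrable_of_lintegral_sub_lt_top (hem v hv) (hneg v hv) h
  have hEeq : ∀ v, Integrable (energyDensity f v) (volume.restrict (S ×ˢ S)) →
      energy S f v = ((∫ w in S ×ˢ S, energyDensity f v w : ℝ) : EReal) := fun v hv =>
    lintegral_sub_eq_integral hv
  -- the coercivity estimates
  obtain ⟨C₁, C₂, hC₁, hY⟩ : ∃ C₁ C₂ : ℝ, 0 ≤ C₁ ∧ ∀ v ∈ admissibleClass Ω Γ p α₁ u₀,
      ∫ x in S, ‖v x‖ ^ p ≤
        C₁ * (∫ w in S ×ˢ S, pairKernel α₁ w * ‖hatDiff v w‖ ^ p) + C₂ := by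
    set X₀ := ∫ w in S ×ˢ S, pairKernel α₁ w * ‖hatDiff u₀ w‖ ^ p with hX₀
    set Y₀ := ∫ x in S, ‖u₀ x‖ ^ p with hY₀
    -- Poincaré applies to `v - u₀`; each passage between `v` and `v - u₀` costs a factor `2 ^ p`.
    refine ⟨2 ^ p * (CP * 2 ^ p), 2 ^ p * (CP * (2 ^ p * X₀) + Y₀), by positivity, fun v hv => ?_⟩
    have h1 := nonlocalW_sub hp0 hα₁_meas hα₁_nonneg hv.1 hu₀
    have h2 := hPoin _ hv.2
    have h3 := (nonlocalW_of_le_add hp0 hα₁_meas hα₁_nonneg h1.1 hu₀ (hW v hv.1).1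
      (fun x => by
        calc ‖v x‖ = ‖(v - u₀) x + u₀ x‖ := by simp
          _ ≤ _ := norm_add_le _ _)
      (fun w => by
        calc ‖hatDiff v w‖ = ‖hatDiff (v - u₀) w + hatDiff u₀ w‖ := by
              congr 1; simp only [hatDiff, Pi.sub_apply]; abel
          _ ≤ _ := norm_add_le _ _)).2.1
    calc ∫ x in S, ‖v x‖ ^ p ≤ 2 ^ p * ((∫ x in S, ‖(v - u₀) x‖ ^ p) + Y₀) := h3
      _ ≤ 2 ^ p * (CP * (2 ^ p * ((∫ w in S ×ˢ S, pairKernel α₁ w * ‖hatDiff v w‖ ^ p) + X₀))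
          + Y₀) := by
        gcongr
        exact h2.trans (mul_le_mul_of_nonneg_left h1.2 hCP)
      _ = _ := by ring
  obtain ⟨C₃, hX⟩ : ∃ C₃ : ℝ, ∀ v ∈ admissibleClass Ω Γ p α₁ u₀,
      Integrable (energyDensity f v) (volume.restrict (S ×ˢ S)) →
      (∫ w in S ×ˢ S, pairKernel α₁ w * ‖hatDiff v w‖ ^ p) / 2
        ≤ (∫ w in S ×ˢ S, energyDensity f v w) + C₃ := by
    set V := volume.real S with hV
    have hV0 : 0 ≤ V := measureReal_nonneg
    -- Small enough that, after `hY`, the `ε`-term takes up at most half of the seminorm integral;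
    -- the `+ 1` keeps the denominator positive.
    set ε : ℝ := (2 * (V * C₁ + 1))⁻¹ with hε
    have hε0 : 0 < ε := by positivity
    have hεV : ε * (V * C₁) ≤ 1 / 2 := by
      rw [hε, inv_mul_eq_div, div_le_iff₀ (by positivity)]
      linarith
    obtain ⟨b, hb, hbf⟩ := hlow ε hε0
    refine ⟨ε * (V * C₂) + ∫ w in S ×ˢ S, b w, fun v hv hev => ?_⟩
    have h1 := hfst v hv.1
    have h1' : Integrable (fun w => ε * ‖v w.1‖ ^ p + b w) (volume.restrict (S ×ˢ S)) :=
      (h1.1.const_mul ε).add hb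
    have h2 : ∫ w in S ×ˢ S, pairKernel α₁ w * ‖hatDiff v w‖ ^ p ≤
        ∫ w in S ×ˢ S, (energyDensity f v w + (ε * ‖v w.1‖ ^ p + b w)) :=
      integral_mono_ae (hW v hv.1).2.2 (hev.add h1') (hbf.mono fun w hw => hw v)
    rw [integral_add hev h1', integral_add (h1.1.const_mul ε) hb, integral_const_mul, h1.2] at h2
    have hX0 := integral_nonneg_of_ae (hpos v hv.1)
    have h3 : ε * (V * ∫ x in S, ‖v x‖ ^ p) ≤
        ε * (V * (C₁ * (∫ w in S ×ˢ S, pairKernel α₁ w * ‖hatDiff v w‖ ^ p) + C₂)) := by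
      gcongr
      exact hY v hv
    have h4 := mul_le_mul_of_nonneg_right hεV hX0
    linarith
  -- the infimum over the members of finite energy
  set I : Set ℝ := {t | ∃ v ∈ admissibleClass Ω Γ p α₁ u₀,
    Integrable (energyDensity f v) (volume.restrict (S ×ˢ S)) ∧
      ∫ w in S ×ˢ S, energyDensity f v w = t} with hI
  have hIne : I.Nonempty := ⟨_, u₀, hu₀A, hEint u₀ hu₀ hFu₀, rfl⟩
  have hIbdd : BddBelow I := by
    refine ⟨-C₃, ?_⟩
    rintro _ ⟨v, hv, hev, rfl⟩
    have h1 := hX v hv hev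
    have h2 : 0 ≤ ∫ w in S ×ˢ S, pairKernel α₁ w * ‖hatDiff v w‖ ^ p :=
      integral_nonneg_of_ae (hpos v hv.1)
    linarith
  set m : ℝ := sInf I with hm
  set K : ℕ → Set (EuclideanSpace ℝ (Fin n) → EuclideanSpace ℝ (Fin N)) := fun k =>
    {v | v ∈ admissibleClass Ω Γ p α₁ u₀ ∧
      Integrable (energyDensity f v) (volume.restrict (S ×ˢ S)) ∧
      ∫ w in S ×ˢ S, energyDensity f v w ≤ m + 1 / ((k : ℝ) + 1)} with hK
  have hKanti : Antitone K := fun i j hij v ⟨h1, h2, h3⟩ =>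
    ⟨h1, h2, h3.trans (by gcongr)⟩
  have hKne : ∀ k, (K k).Nonempty := by
    intro k
    obtain ⟨_, ⟨v, hv, hev, rfl⟩, hlt⟩ := exists_lt_of_csInf_lt hIne
      (lt_add_of_pos_right m (show 0 < 1 / ((k : ℝ) + 1) by positivity))
    exact ⟨v, hv, hev, hlt.le⟩
  have hKmid : ∀ k, ∀ a ∈ K k, ∀ b ∈ K k, (1 / 2 : ℝ) • (a + b) ∈ K k := by
    rintro k a ⟨ha, hea, ha'⟩ b ⟨hb, heb, hb'⟩
    have hWm : (1 / 2 : ℝ) • (a + b) ∈ nonlocalW N S p α₁ :=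
      nonlocalW_midpoint hp0 hα₁_meas hα₁_nonneg ha.1 hb.1
    have hup : ∀ᵐ w ∂(volume.restrict (S ×ˢ S)), energyDensity f ((1 / 2 : ℝ) • (a + b)) w ≤
        (energyDensity f a w + energyDensity f b w) / 2 :=
      hf_conv.mono fun w hw => energyDensity_midpoint_le hw a b
    have hupi := (hea.add heb).div_const 2
    -- Without upper growth, integrability comes from a sandwich: coercivity below, the average of
    -- two integrable densities above.
    have hint : Integrable (energyDensity f ((1 / 2 : ℝ) • (a + b)))
        (volume.restrict (S ×ˢ S)) := by
      obtain ⟨c, hc, hcf⟩ := hlow 1 one_pos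
      have hl := ((hfst _ hWm).1.const_mul 1).add hc
      refine integrable_of_le_of_le (hem _ hWm).aestronglyMeasurable ?_ hup hl.neg hupi
      filter_upwards [hcf, hpos _ hWm] with w h1 h2
      have h3 := h2.trans (h1 ((1 / 2 : ℝ) • (a + b)))
      simp only [Pi.neg_apply, Pi.add_apply, Pi.zero_apply] at h3 ⊢
      linarith
    refine ⟨(hA _).2 ⟨hWm, ?_⟩, hint, ?_⟩
    · filter_upwards [((hA a).1 ha).2, ((hA b).1 hb).2] with x h1 h2
      rw [Pi.smul_apply, Pi.add_apply, h1, h2]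
      module
    · have h := integral_mono_ae hint hupi hup
      simp only [Pi.add_apply] at h
      rw [integral_div, integral_add hea heb] at h
      linarith
  -- `K 0` has level `m + 1`; the `2` undoes the half in `hX`.
  set MX : ℝ := 2 * (m + 1 + C₃) with hMX
  have hKX : ∀ v ∈ K 0, ∫ w in S ×ˢ S, pairKernel α₁ w * ‖hatDiff v w‖ ^ p ≤ MX := by
    rintro v ⟨hv, hev, hle⟩
    have := hX v hv hev
    norm_num at hle
    linarith
  set MY : ℝ := C₁ * MX + C₂ with hMY
  have hKY : ∀ v ∈ K 0, ∫ x in S, ‖v x‖ ^ p ≤ MY := fun v hv =>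
    by
    have := mul_le_mul_of_nonneg_left (hKX v hv) hC₁
    linarith [hY v hv.1]
  have hle1 : ∀ t : ℝ, 0 ≤ t → t ≤ 1 + t ^ p := by
    intro t ht
    rcases le_total t 1 with h | h
    · linarith [Real.rpow_nonneg ht p]
    · linarith [Real.self_le_rpow_of_one_le h hp.le]
  have hKint : ∀ v ∈ K 0, Integrable v (volume.restrict S) := by
    intro v hv
    refine ((integrable_const (1 : ℝ)).add (hW v hv.1.1).2.1).mono' (hW v hv.1.1).1
      (Eventually.of_forall fun x => hle1 _ (norm_nonneg _))
  obtain ⟨v, hvK, hlim⟩ := exists_mem_ae_tendsto_of_antitone hKanti hKne hKmid hKint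
    (C := volume.real S + MY) (fun v hv => by
      calc ∫ x in S, ‖v x‖ ≤ ∫ x in S, (1 + ‖v x‖ ^ p) :=
            integral_mono (hKint v hv).norm ((integrable_const (1 : ℝ)).add (hW v hv.1.1).2.1)
              fun x => hle1 _ (norm_nonneg _)
        _ = volume.real S + ∫ x in S, ‖v x‖ ^ p := by
            rw [integral_add (integrable_const _) (hW v hv.1.1).2.1]; simp
        _ ≤ _ := by gcongr; exact hKY v hv)
  obtain ⟨u, hu⟩ : ∃ u : EuclideanSpace ℝ (Fin n) → EuclideanSpace ℝ (Fin N),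
      ∀ᵐ x ∂(volume.restrict S), Tendsto (fun k => v k x) atTop (𝓝 (u x)) :=
    ⟨fun x => limUnder atTop fun k => v k x, hlim.mono fun x hx => tendsto_nhds_limUnder hx⟩
  have hu2 := ae_prod_self_of_ae hu
  have hvK0 : ∀ k, v k ∈ K 0 := fun k => hKanti (Nat.zero_le k) (hvK k)
  have hvW : ∀ k, v k ∈ nonlocalW N S p α₁ := fun k => (hvK k).1.1
  have hum : AEStronglyMeasurable u (volume.restrict S) :=
    aestronglyMeasurable_of_tendsto_ae atTop (fun k => (hW _ (hvW k)).1) hu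
  have hrpow : Continuous fun t : ℝ => t ^ p := Real.continuous_rpow_const hp0.le
  have hYu := integrable_and_integral_le_of_tendsto_ae (g' := fun x => ‖u x‖ ^ p)
    (fun k => (hW _ (hvW k)).2.1) (fun k => Eventually.of_forall fun x => by positivity)
    (hu.mono fun x hx => (hrpow.tendsto _).comp hx.norm) (fun k => hKY _ (hvK0 k))
  have hXu := integrable_and_integral_le_of_tendsto_ae
    (g' := fun w => pairKernel α₁ w * ‖hatDiff u w‖ ^ p)
    (fun k => (hW _ (hvW k)).2.2) (fun k => hpos _ (hvW k))
    (hu2.mono fun w hw => ((hrpow.tendsto _).comp (hw.2.sub hw.1).norm).const_mul _)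
    (fun k => hKX _ (hvK0 k))
  have huW : u ∈ nonlocalW N S p α₁ :=
    (mem_nonlocalW_iff hp0 hα₁_meas).2 ⟨hum, hYu.1, hXu.1⟩
  have huA : u ∈ admissibleClass Ω Γ p α₁ u₀ := by
    refine (hA u).2 ⟨huW, ?_⟩
    -- On `Γ` the sequence is a.e. constantly `u₀`, so its limit is too.
    filter_upwards [ae_restrict_of_ae_restrict_of_subset subset_union_right hu,
      ae_all_iff.2 fun k => ((hA _).1 (hvK k).1).2] with x h1 h2
    simp only [h2] at h1
    exact tendsto_nhds_unique h1 tendsto_const_nhds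
  -- lower semicontinuity along the sequence
  have hlsc : ∀ ε : ℝ, 0 < ε → ∀ j : ℕ,
      Integrable (energyDensity f u) (volume.restrict (S ×ˢ S)) ∧
      ∫ w in S ×ˢ S, energyDensity f u w ≤
        m + 1 / ((j : ℝ) + 1) + ε * (volume.real S * MY) := by
    intro ε hε j
    obtain ⟨b, hb, hbf⟩ := hlow ε hε
    have hh : ∀ w ∈ nonlocalW N S p α₁,
        Integrable (fun z => ε * ‖w z.1‖ ^ p + b z) (volume.restrict (S ×ˢ S)) := fun w hw =>
      ((hfst w hw).1.const_mul ε).add hb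
    -- The added term makes the densities nonnegative for Fatou; starting at index `j` keeps every
    -- member in `K j`. The integral of `b` cancels afterwards, leaving an error proportional to
    -- `ε`.
    have hF := integrable_and_integral_le_of_tendsto_ae
      (g := fun k w => energyDensity f (v (k + j)) w + (ε * ‖v (k + j) w.1‖ ^ p + b w))
      (g' := fun w => energyDensity f u w + (ε * ‖u w.1‖ ^ p + b w))
      (c := m + 1 / ((j : ℝ) + 1) + (ε * (volume.real S * MY) + ∫ w in S ×ˢ S, b w))
      (fun k => (hvK (k + j)).2.1.add (hh _ (hvW (k + j))))
      (fun k => by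
        filter_upwards [hbf, hpos _ (hvW (k + j))] with w h1 h2
        exact h2.trans (h1 _))
      (by
        filter_upwards [hu2, hf_cont] with w h1 h2
        have h3 := tendsto_energyDensity h2 h1.1 h1.2
        have h4 := h3.add ((((hrpow.tendsto _).comp h1.1.norm).const_mul ε).add_const (b w))
        exact h4.comp (tendsto_add_atTop_nat j))
      (fun k => by
        rw [integral_add (hvK (k + j)).2.1 (hh _ (hvW (k + j))),
          integral_add ((hfst _ (hvW (k + j))).1.const_mul ε) hb, integral_const_mul,
          (hfst _ (hvW (k + j))).2]
        gcongr
        · exact (hKanti (Nat.le_add_left j k) (hvK (k + j))).2.2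
        · exact hKY _ (hvK0 _))
    have hi : Integrable (energyDensity f u) (volume.restrict (S ×ˢ S)) := by
      refine (hF.1.sub (hh u huW)).congr (Eventually.of_forall fun w => ?_)
      simp
    refine ⟨hi, ?_⟩
    have h5 := hF.2.2
    rw [integral_add hi (hh u huW), integral_add ((hfst _ huW).1.const_mul ε) hb, integral_const_mul,
      (hfst _ huW).2] at h5
    have h6 : 0 ≤ ε * (volume.real S * ∫ x in S, ‖u x‖ ^ p) :=
      mul_nonneg hε.le (mul_nonneg measureReal_nonneg
        (integral_nonneg fun x => by positivity))
    linarith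
  have hui := (hlsc 1 one_pos 0).1
  have hule : ∫ w in S ×ˢ S, energyDensity f u w ≤ m := by
    -- Level and error are sent to zero together, with `ε = 1 / (j + 1)`.
    have hlim0 : Tendsto (fun j : ℕ => m + 1 / ((j : ℝ) + 1)
        + 1 / ((j : ℝ) + 1) * (volume.real S * MY)) atTop (𝓝 (m + 0 + 0 * (volume.real S * MY))) :=
      (tendsto_one_div_add_atTop_nhds_zero_nat.const_add m).add
        (tendsto_one_div_add_atTop_nhds_zero_nat.mul_const _)
    have := ge_of_tendsto' hlim0 fun j => (hlsc (1 / ((j : ℝ) + 1)) (by positivity) j).2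
    simpa using this
  refine ⟨fun w hw => hneg w hw.1, u, huA, le_antisymm (le_sInf ?_) (sInf_le ⟨u, huA, rfl⟩)⟩
  rintro _ ⟨w, hw, rfl⟩
  rcases eq_or_ne (energy S f w) ⊤ with h | h
  · rw [h]; exact le_top
  · have hwi := hEint w hw.1 (lt_top_iff_ne_top.2 h)
    rw [hEeq u hui, hEeq w hwi, EReal.coe_le_coe_iff]
    exact hule.trans (csInf_le hIbdd ⟨w, hw, hwi, rfl⟩)
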